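/- Let $\mathbb{A}$ be a strict monoidal category with unit $I$; composition is written in diagrammatic order. The category $\mathsf{Optic}_{\mathbb{A}}$ has as objects the pairs $(A,B)$ of objects of $\mathbb{A}$. Its arrows $(A,B)\to(C,D)$ are the triples $\langle\alpha\mid\beta\rangle_M$, with $M$ an object and $\alpha:A\to M\otimes C$, $\beta:M\otimes D\to B$ arrows of $\mathbb{A}$, modulo the equivalence relation generated by $\langle\alpha(f\otimes 1_C)\mid\beta\rangle_N=\langle\alpha\mid(f\otimes 1_D)\beta\rangle_M$ for $f:M\to N$. Composition is $\langle\alpha\mid\beta\rangle_M\langle\gamma\mid\delta\rangle_N=\langle\alpha(1_M\otimes\gamma)\mid(1_M\otimes\delta)\beta\rangle_{M\otimes N}$, and identities are $\langle 1_A\mid 1_B\rangle_I$. The free cornering $\ulcorner\mathbb{A}\urcorner$ is the (strict) double category with a single object whose horizontal edge monoid is the monoid of objects of $\mathbb{A}$ under $\otimes$, whose vertical edge monoid is the free monoid (also written $\otimes$, with unit $I$) on the symbols $A^\circ,A^\bullet$ for $A$ an object of $\mathbb{A}$, and whose cells are freely generated, under horizontal composition $a\,|\,b$ and vertical composition $\frac{a}{b}$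 ($a$ above $b$), as follows. Write a cell as (left; top; bottom; right). The generators are a cell $\ulcorner f\urcorner:(I;A;B;I)$ for each arrow $f:A\to B$ of $\mathbb{A}$, and corner cells $(I;A;I;A^\circ)$, $(A^\circ;I;A;I)$, $(I;I;A;A^\bullet)$, $(A^\bullet;A;I;I)$ for each object $A$. They are subject to $\ulcorner 1_A\urcorner=1_A$, $\ulcorner fg\urcorner=\frac{\ulcorner f\urcorner}{\ulcorner g\urcorner}$, $\ulcorner f\otimes g\urcorner=\ulcorner f\urcorner\,|\,\ulcorner g\urcorner$ and to the yanking equations: the horizontal and the vertical composites of the two $\circ$-corners of $A$ are the identity cells of $A$ and of $A^\circ$, and those of the two $\bullet$-corners are the identity cells of $A$ and of $A^\bullet$. Let $\mathbf{H}\ulcorner\mathbb{A}\urcorner$ be the category with the vertical edges as objects, the cells $(X;I;I;Y)$ as arrows $X\to Y$, and horizontal composition. For $\alpha:A\to M\otimes C$ and $\beta:M\otimes D\to B$ let $[\alpha\mid\beta]_M:A^\circ\otimes B^\bullet\to C^\circ\otimes D^\bullet$ be the arrow of $\mathbf{H}\ulcorner\mathbb{A}\urcorner$ given by the vertical composite,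 from top to bottom, of $(A^\circ;I;A;I)$, $\ulcorner\alpha\urcorner$, $1_M\,|\,(I;C;I;C^\circ)$, $1_M\,|\,(I;I;D;D^\bullet)$, $\ulcorner\beta\urcorner$ and $(B^\bullet;B;I;I)$. Theorem. The category $\mathsf{Optic}_{\mathbb{A}}$ is isomorphic to the full subcategory of $\mathbf{H}\ulcorner\mathbb{A}\urcorner$ on the objects of the form $A^\circ\otimes B^\bullet$, by an isomorphism of categories that sends $(A,B)$ to $A^\circ\otimes B^\bullet$ and $\langle\alpha\mid\beta\rangle_M$ to $[\alpha\mid\beta]_M$. Moreover, for all objects $A,B,C,D$ of $\mathbb{A}$ there is a bijection $$\mathbf{H}\ulcorner\mathbb{A}\urcorner(A^\circ\otimes B^\bullet,\;C^\circ\otimes D^\bullet)\;\cong\;\int^{M}\mathbb{A}(A,M\otimes C)\times\mathbb{A}(M\otimes D,B)$$ under which $[\alpha\mid\beta]_M$ corresponds to the class of $(\alpha,\beta)$ at $M$. -/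

import Mathlib

open CategoryTheory MonoidalCategory Opposite

universe v u w₁ w₂ w₃

/-! ### Strict monoidal categories -/

/-- A monoidal category is strict when tensoring is associative and unital on the nose on objects,
and the structural isomorphisms are the identities (transported along these equalities). -/
class StrictMonoidal (A : Type u) [Category.{v} A] [MonoidalCategory A] : Prop where
  tensor_assoc (X Y Z : A) : (X ⊗ Y) ⊗ Z = X ⊗ (Y ⊗ Z)
  unit_tensor (X : A) : 𝟙_ A ⊗ X = X
  tensor_unit (X : A) : X ⊗ 𝟙_ A = X
  associator_eq (X Y Z : A) : α_ X Y Z = eqToIso (tensor_assoc X Y Z)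
  leftUnitor_eq (X : A) : λ_ X = eqToIso (unit_tensor X)
  rightUnitor_eq (X : A) : ρ_ X = eqToIso (tensor_unit X)

/-- The monoid of objects of a strict monoidal category. -/
abbrev StrictMonoidal.objMonoid (A : Type u) [Category.{v} A] [MonoidalCategory A]
    [StrictMonoidal A] : Monoid A where
  mul X Y := X ⊗ Y
  one := 𝟙_ A
  mul_assoc := StrictMonoidal.tensor_assoc
  one_mul := StrictMonoidal.unit_tensor
  mul_one := StrictMonoidal.tensor_unit

/-! ### The category of optics -/

/-- A representative `⟨α ∣ β⟩_M` of an optic `(P, Q) ⟶ (C, D)`. -/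
structure OpticRep {A : Type u} [Category.{v} A] [MonoidalCategory A] (P Q C D : A) where
  residual : A
  fwd : P ⟶ residual ⊗ C
  bwd : residual ⊗ D ⟶ Q

/-- The generating equations `⟨α (f ⊗ 1) ∣ β⟩_N = ⟨α ∣ (f ⊗ 1) β⟩_M` between optics. -/
inductive OpticRep.Slide {A : Type u} [Category.{v} A] [MonoidalCategory A] {P Q C D : A} :
    OpticRep P Q C D → OpticRep P Q C D → Prop
  | slide {M N : A} (f : M ⟶ N) (α : P ⟶ M ⊗ C) (β : N ⊗ D ⟶ Q) :
      OpticRep.Slide ⟨N, α ≫ f ▷ C, β⟩ ⟨M, α, f ▷ D ≫ β⟩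

/-- Objects of the category of optics: pairs of objects. -/
@[ext]
structure Optic (A : Type u) where
  fst : A
  snd : A

namespace Optic

variable {A : Type u} [Category.{v} A] [MonoidalCategory A]

/-- Arrows of the category of optics: the quotient of the representatives by the equivalence
relation generated by sliding. -/
def Hom (X Y : Optic A) : Type (max u v) :=
  Quot (OpticRep.Slide (P := X.fst) (Q := X.snd) (C := Y.fst) (D := Y.snd))

/-- The optic `⟨α ∣ β⟩_M`. -/
def Hom.mk {X Y : Optic A} (M : A) (α : X.fst ⟶ M ⊗ Y.fst) (β : M ⊗ Y.snd ⟶ X.snd) : Hom X Y :=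
  Quot.mk _ ⟨M, α, β⟩

theorem Hom.slide {X Y : Optic A} {M N : A} (f : M ⟶ N) (α : X.fst ⟶ M ⊗ Y.fst)
    (β : N ⊗ Y.snd ⟶ X.snd) :
    Hom.mk N (α ≫ f ▷ Y.fst) β = Hom.mk M α (f ▷ Y.snd ≫ β) :=
  Quot.sound (OpticRep.Slide.slide f α β)

/-- `1 = ⟨1 ∣ 1⟩_I`. -/
def Hom.id (X : Optic A) : Hom X X :=
  Hom.mk (𝟙_ A) (λ_ X.fst).inv (λ_ X.snd).hom

/-- `⟨α ∣ β⟩_M ⟨γ ∣ δ⟩_N = ⟨α (1 ⊗ γ) ∣ (1 ⊗ δ) β⟩_{M ⊗ N}`. -/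
def Hom.comp {X Y Z : Optic A} : Hom X Y → Hom Y Z → Hom X Z :=
  Quot.map₂
    (fun p q => ⟨p.residual ⊗ q.residual,
      p.fwd ≫ p.residual ◁ q.fwd ≫ (α_ p.residual q.residual Z.fst).inv,
      (α_ p.residual q.residual Z.snd).hom ≫ p.residual ◁ q.bwd ≫ p.bwd⟩)
    (by
      rintro ⟨M, α, β⟩ _ _ ⟨f, γ, δ⟩
      simpa using OpticRep.Slide.slide (M ◁ f) (α ≫ M ◁ γ ≫ (α_ _ _ _).inv)
        ((α_ _ _ _).hom ≫ M ◁ δ ≫ β))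
    (by
      rintro _ _ ⟨N, γ, δ⟩ ⟨f, α, β⟩
      have h := OpticRep.Slide.slide (f ▷ N) (α ≫ _ ◁ γ ≫ (α_ _ _ _).inv)
        ((α_ _ _ _).hom ≫ _ ◁ δ ≫ β)
      have e : f ▷ N ▷ Z.snd ≫ (α_ _ N Z.snd).hom ≫ _ ◁ δ ≫ β =
          (α_ _ N Z.snd).hom ≫ _ ◁ δ ≫ f ▷ Y.snd ≫ β := by
        simp [whisker_exchange_assoc]
      rw [e] at h
      simpa [← whisker_exchange_assoc] using h)

theorem Hom.mk_comp_mk {X Y Z : Optic A} (M N : A) (α : X.fst ⟶ M ⊗ Y.fst)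
    (β : M ⊗ Y.snd ⟶ X.snd) (γ : Y.fst ⟶ N ⊗ Z.fst) (δ : N ⊗ Z.snd ⟶ Y.snd) :
    Hom.comp (Hom.mk M α β) (Hom.mk N γ δ) =
      Hom.mk (M ⊗ N) (α ≫ M ◁ γ ≫ (α_ M N Z.fst).inv) ((α_ M N Z.snd).hom ≫ M ◁ δ ≫ β) :=
  rfl

instance : Category.{max u v} (Optic A) where
  Hom := Hom
  id := Hom.id
  comp := Hom.comp
  id_comp := by
    rintro X Y ⟨⟨M, α, β⟩⟩
    have h := Hom.slide (X := X) (Y := Y) (λ_ M).inv α ((λ_ M).hom ▷ _ ≫ β)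
    refine Eq.trans ?_ (h.trans ?_)
    · refine (Hom.mk_comp_mk _ _ _ _ _ _).trans ?_
      congr 1 <;> simp
    · simp [Hom.mk]
      rfl
  comp_id := by
    rintro X Y ⟨⟨M, α, β⟩⟩
    have h := Hom.slide (X := X) (Y := Y) (ρ_ M).inv α ((ρ_ M).hom ▷ _ ≫ β)
    refine Eq.trans ?_ (h.trans ?_)
    · refine (Hom.mk_comp_mk _ _ _ _ _ _).trans ?_
      congr 1 <;> simp
    · simp [Hom.mk]
      rfl
  assoc := by
    rintro W X Y Z ⟨⟨M, α, β⟩⟩ ⟨⟨N, γ, δ⟩⟩ ⟨⟨K, ε, ζ⟩⟩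
    have h := Hom.slide (X := W) (Y := Z) (α_ M N K).hom
      (α ≫ M ◁ γ ≫ (α_ _ _ _).inv ≫ _ ◁ ε ≫ (α_ _ _ _).inv)
      ((α_ _ _ _).hom ≫ M ◁ ((α_ _ _ _).hom ≫ N ◁ ζ ≫ δ) ≫ β)
    refine Eq.trans ?_ (h.symm.trans ?_)
    · change Hom.comp (Hom.comp (Hom.mk M α β) (Hom.mk N γ δ)) (Hom.mk K ε ζ) = _
      rw [Hom.mk_comp_mk, Hom.mk_comp_mk]
      congr 1 <;> simp
    · change _ = Hom.comp (Hom.mk M α β) (Hom.comp (Hom.mk N γ δ) (Hom.mk K ε ζ))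
      rw [Hom.mk_comp_mk, Hom.mk_comp_mk]
      congr 1; simp

/-- The arrow `⟨α ∣ β⟩_M` of the category of optics. -/
def homMk {X Y : Optic A} (M : A) (α : X.fst ⟶ M ⊗ Y.fst) (β : M ⊗ Y.snd ⟶ X.snd) : X ⟶ Y :=
  Hom.mk M α β

end Optic

/-- The bifunctor `(M, N) ↦ A(P, N ⊗ C) × A(M ⊗ D, Q)`, contravariant in `M` and covariant in
`N`. -/
def opticBifunctor {A : Type u} [Category.{v} A] [MonoidalCategory A] (P Q C D : A) :
    Aᵒᵖ ⥤ A ⥤ Type (max u v) where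
  obj M :=
    { obj N := ULift.{u} ((P ⟶ N ⊗ C) × (M.unop ⊗ D ⟶ Q))
      map g := TypeCat.ofHom fun p => ⟨(p.down.1 ≫ g ▷ C, p.down.2)⟩
      map_id N := by ext <;> simp
      map_comp f g := by ext <;> simp }
  map f :=
    { app N := TypeCat.ofHom fun p => ⟨(p.down.1, f.unop ▷ D ≫ p.down.2)⟩
      naturality _ _ g := by ext <;> simp }
  map_id M := by ext <;> simp
  map_comp f g := by ext <;> simp

/-! ### Single object double categories -/

/-- A (strict) double category with exactly one object. `Cell X S T Y` is the set of cells with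
left boundary `X`, top boundary `S`, bottom boundary `T` and right boundary `Y`. Heterogeneous
equalities relate cells whose boundaries agree by the monoid laws. -/
structure SingleObjectDoubleCategory where
  /-- the horizontal edge monoid -/
  H : Type w₁
  /-- the vertical edge monoid -/
  V : Type w₂
  [monoidH : Monoid H]
  [monoidV : Monoid V]
  Cell : V → H → H → V → Type w₃
  /-- horizontal identity cell -/
  hid (X : V) : Cell X 1 1 X
  /-- vertical identity cell -/
  vid (S : H) : Cell 1 S S 1
  /-- horizontal composite `a | b` -/
  hcomp {X Y Z : V} {S T S' T' : H} :
    Cell X S T Y → Cell Y S' T' Z → Cell X (S * S') (T * T') Z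
  /-- vertical composite: the first cell above the second -/
  vcomp {X Y X' Y' : V} {S T U : H} :
    Cell X S T Y → Cell X' T U Y' → Cell (X * X') S U (Y * Y')
  hcomp_assoc {X Y Z W : V} {S T S' T' S'' T'' : H} (a : Cell X S T Y) (b : Cell Y S' T' Z)
    (c : Cell Z S'' T'' W) : hcomp (hcomp a b) c ≍ hcomp a (hcomp b c)
  hid_hcomp {X Y : V} {S T : H} (a : Cell X S T Y) : hcomp (hid X) a ≍ a
  hcomp_hid {X Y : V} {S T : H} (a : Cell X S T Y) : hcomp a (hid Y) ≍ a
  vcomp_assoc {X Y X' Y' X'' Y'' : V} {S T U R : H} (a : Cell X S T Y) (b : Cell X' T U Y')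
    (c : Cell X'' U R Y'') : vcomp (vcomp a b) c ≍ vcomp a (vcomp b c)
  vid_vcomp {X Y : V} {S T : H} (a : Cell X S T Y) : vcomp (vid S) a ≍ a
  vcomp_vid {X Y : V} {S T : H} (a : Cell X S T Y) : vcomp a (vid T) ≍ a
  hid_mul (X Y : V) : vcomp (hid X) (hid Y) = hid (X * Y)
  vid_mul (S T : H) : hcomp (vid S) (vid T) = vid (S * T)
  hid_one : hid 1 = vid 1
  interchange {X Y Z X' Y' Z' : V} {S T U S' T' U' : H} (a : Cell X S T Y) (b : Cell X' T U Y')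
    (c : Cell Y S' T' Z) (d : Cell Y' T' U' Z') :
    hcomp (vcomp a b) (vcomp c d) = vcomp (hcomp a c) (hcomp b d)

attribute [instance] SingleObjectDoubleCategory.monoidH SingleObjectDoubleCategory.monoidV

/-- Objects of the category of horizontal cells of `𝔻`: the vertical edges. -/
@[ext]
structure HorizontalCells (𝔻 : SingleObjectDoubleCategory.{w₁, w₂, w₃}) where
  edge : 𝔻.V

namespace HorizontalCells

variable {𝔻 : SingleObjectDoubleCategory.{w₁, w₂, w₃}}

/-- Horizontal composition of cells whose top and bottom boundaries are trivial. -/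
def comp {X Y Z : 𝔻.V} (a : 𝔻.Cell X 1 1 Y) (b : 𝔻.Cell Y 1 1 Z) : 𝔻.Cell X 1 1 Z :=
  cast (by rw [mul_one]) (𝔻.hcomp a b)

theorem comp_heq {X Y Z : 𝔻.V} (a : 𝔻.Cell X 1 1 Y) (b : 𝔻.Cell Y 1 1 Z) :
    comp a b ≍ 𝔻.hcomp a b :=
  cast_heq _ _

theorem hcomp_congr {X Y Z : 𝔻.V} {S T S' T' S₁ T₁ S₁' T₁' : 𝔻.H}
    {a : 𝔻.Cell X S T Y} {a₁ : 𝔻.Cell X S₁ T₁ Y} {b : 𝔻.Cell Y S' T' Z} {b₁ : 𝔻.Cell Y S₁' T₁' Z}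
    (hS : S = S₁) (hT : T = T₁) (hS' : S' = S₁') (hT' : T' = T₁') (ha : a ≍ a₁) (hb : b ≍ b₁) :
    𝔻.hcomp a b ≍ 𝔻.hcomp a₁ b₁ := by
  subst hS hT hS' hT'
  cases ha
  cases hb
  rfl

/-- Horizontal cells: the cells with trivial top and bottom boundary, under horizontal
composition. -/
instance : Category.{w₃} (HorizontalCells 𝔻) where
  Hom X Y := 𝔻.Cell X.edge 1 1 Y.edge
  id X := 𝔻.hid X.edge
  comp a b := comp a b
  id_comp a := eq_of_heq ((comp_heq _ _).trans (𝔻.hid_hcomp a))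
  comp_id a := eq_of_heq ((comp_heq _ _).trans (𝔻.hcomp_hid a))
  assoc a b c := eq_of_heq <|
    (comp_heq _ _).trans <|
    (hcomp_congr (mul_one 1).symm (mul_one 1).symm rfl rfl (comp_heq a b) HEq.rfl).trans <|
    (𝔻.hcomp_assoc a b c).trans <|
    (hcomp_congr rfl rfl (mul_one 1) (mul_one 1) HEq.rfl (comp_heq b c).symm).trans
    (comp_heq _ _).symm

end HorizontalCells

/-! ### The free cornering -/

/-- The two polarities `∘` and `•`. -/
inductive Polarity
  | circ
  | bullet

/-- The vertical edge monoid of the free cornering: the free monoid on polarized objects. -/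
abbrev Exchange (A : Type u) : Type u := FreeMonoid (A × Polarity)

/-- The generator `P°`. -/
def circ {A : Type u} (P : A) : Exchange A := FreeMonoid.of (P, Polarity.circ)

/-- The generator `P•`. -/
def bullet {A : Type u} (P : A) : Exchange A := FreeMonoid.of (P, Polarity.bullet)

/-- Formal composites of the generating cells of the free cornering. -/
inductive CornerExpr (A : Type u) [Category.{v} A] [MonoidalCategory A] :
    Exchange A → A → A → Exchange A → Type (max u v)
  /-- the vertical cell given by an arrow -/
  | gen {P Q : A} (f : P ⟶ Q) : CornerExpr A 1 P Q 1
  /-- the corner that sends `P` away along the right boundary -/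
  | circR (P : A) : CornerExpr A 1 P (𝟙_ A) (circ P)
  /-- the corner that receives `P` along the left boundary -/
  | circL (P : A) : CornerExpr A (circ P) (𝟙_ A) P 1
  /-- the corner that receives `P` along the right boundary -/
  | bulletR (P : A) : CornerExpr A 1 (𝟙_ A) P (bullet P)
  /-- the corner that sends `P` away along the left boundary -/
  | bulletL (P : A) : CornerExpr A (bullet P) P (𝟙_ A) 1
  | hid (X : Exchange A) : CornerExpr A X (𝟙_ A) (𝟙_ A) X
  | vid (S : A) : CornerExpr A 1 S S 1
  | hcomp {X Y Z : Exchange A} {S T S' T' : A} :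
      CornerExpr A X S T Y → CornerExpr A Y S' T' Z → CornerExpr A X (S ⊗ S') (T ⊗ T') Z
  | vcomp {X Y X' Y' : Exchange A} {S T U : A} :
      CornerExpr A X S T Y → CornerExpr A X' T U Y' → CornerExpr A (X * X') S U (Y * Y')

namespace CornerExpr

variable {A : Type u} [Category.{v} A] [MonoidalCategory A]

/-- Transport of a formal composite along equalities of its boundaries. -/
def recast {X X' Y Y' : Exchange A} {S S' T T' : A} (hX : X = X') (hS : S = S') (hT : T = T')
    (hY : Y = Y') (a : CornerExpr A X S T Y) : CornerExpr A X' S' T' Y' :=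
  cast (by rw [hX, hS, hT, hY]) a

variable [StrictMonoidal A]

open StrictMonoidal

/-- The equations of the free cornering: those of a double category, functoriality of the
inclusion of `A` as vertical cells, the yanking equations, and congruence. -/
inductive Rel : ∀ {X Y : Exchange A} {S T : A},
    CornerExpr A X S T Y → CornerExpr A X S T Y → Prop
  -- congruence for the two compositions
  | hcomp_left {X Y Z : Exchange A} {S T S' T' : A} {a a' : CornerExpr A X S T Y}
      (h : Rel a a') (b : CornerExpr A Y S' T' Z) : Rel (hcomp a b) (hcomp a' b)
  | hcomp_right {X Y Z : Exchange A} {S T S' T' : A} (a : CornerExpr A X S T Y)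
      {b b' : CornerExpr A Y S' T' Z} (h : Rel b b') : Rel (hcomp a b) (hcomp a b')
  | vcomp_left {X Y X' Y' : Exchange A} {S T U : A} {a a' : CornerExpr A X S T Y}
      (h : Rel a a') (b : CornerExpr A X' T U Y') : Rel (vcomp a b) (vcomp a' b)
  | vcomp_right {X Y X' Y' : Exchange A} {S T U : A} (a : CornerExpr A X S T Y)
      {b b' : CornerExpr A X' T U Y'} (h : Rel b b') : Rel (vcomp a b) (vcomp a b')
  -- axioms of a double category
  | hcomp_assoc {X Y Z W : Exchange A} {S T S' T' S'' T'' : A} (a : CornerExpr A X S T Y)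
      (b : CornerExpr A Y S' T' Z) (c : CornerExpr A Z S'' T'' W) :
      Rel (recast rfl (tensor_assoc _ _ _) (tensor_assoc _ _ _) rfl (hcomp (hcomp a b) c))
        (hcomp a (hcomp b c))
  | hid_hcomp {X Y : Exchange A} {S T : A} (a : CornerExpr A X S T Y) :
      Rel (recast rfl (unit_tensor _) (unit_tensor _) rfl (hcomp (hid X) a)) a
  | hcomp_hid {X Y : Exchange A} {S T : A} (a : CornerExpr A X S T Y) :
      Rel (recast rfl (tensor_unit _) (tensor_unit _) rfl (hcomp a (hid Y))) a
  | vcomp_assoc {X Y X' Y' X'' Y'' : Exchange A} {S T U R : A} (a : CornerExpr A X S T Y)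
      (b : CornerExpr A X' T U Y') (c : CornerExpr A X'' U R Y'') :
      Rel (recast (mul_assoc _ _ _) rfl rfl (mul_assoc _ _ _) (vcomp (vcomp a b) c))
        (vcomp a (vcomp b c))
  | vid_vcomp {X Y : Exchange A} {S T : A} (a : CornerExpr A X S T Y) :
      Rel (recast (one_mul _) rfl rfl (one_mul _) (vcomp (vid S) a)) a
  | vcomp_vid {X Y : Exchange A} {S T : A} (a : CornerExpr A X S T Y) :
      Rel (recast (mul_one _) rfl rfl (mul_one _) (vcomp a (vid T))) a
  | hid_mul (X Y : Exchange A) : Rel (vcomp (hid X) (hid Y)) (hid (X * Y))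
  | vid_tensor (S T : A) : Rel (hcomp (vid S) (vid T)) (vid (S ⊗ T))
  | hid_one : Rel (hid 1) (vid (𝟙_ A))
  | interchange {X Y Z X' Y' Z' : Exchange A} {S T U S' T' U' : A} (a : CornerExpr A X S T Y)
      (b : CornerExpr A X' T U Y') (c : CornerExpr A Y S' T' Z) (d : CornerExpr A Y' T' U' Z') :
      Rel (hcomp (vcomp a b) (vcomp c d)) (vcomp (hcomp a c) (hcomp b d))
  -- equations between the cells given by arrows
  | gen_id (P : A) : Rel (gen (𝟙 P)) (vid P)
  | gen_comp {P Q R : A} (f : P ⟶ Q) (g : Q ⟶ R) :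
      Rel (recast (mul_one 1) rfl rfl (mul_one 1) (vcomp (gen f) (gen g))) (gen (f ≫ g))
  | gen_tensor {P Q P' Q' : A} (f : P ⟶ Q) (g : P' ⟶ Q') :
      Rel (hcomp (gen f) (gen g)) (gen (f ⊗ₘ g))
  -- yanking equations
  | circ_yank_h (P : A) :
      Rel (recast rfl (tensor_unit P) (unit_tensor P) rfl (hcomp (circR P) (circL P))) (vid P)
  | circ_yank_v (P : A) :
      Rel (recast (mul_one _) rfl rfl (one_mul _) (vcomp (circL P) (circR P))) (hid (circ P))
  | bullet_yank_h (P : A) :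
      Rel (recast rfl (unit_tensor P) (tensor_unit P) rfl (hcomp (bulletR P) (bulletL P))) (vid P)
  | bullet_yank_v (P : A) :
      Rel (recast (one_mul _) rfl rfl (mul_one _) (vcomp (bulletR P) (bulletL P)))
        (hid (bullet P))

theorem mk_heq_of_rel_recast {X X' Y Y' : Exchange A} {S S' T T' : A} (hX : X = X') (hS : S = S')
    (hT : T = T') (hY : Y = Y') {a : CornerExpr A X S T Y} {b : CornerExpr A X' S' T' Y'}
    (h : Rel (recast hX hS hT hY a) b) :
    Quot.mk (Rel (X := X) (Y := Y) (S := S) (T := T)) a ≍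
      Quot.mk (Rel (X := X') (Y := Y') (S := S') (T := T')) b := by
  subst hX hS hT hY
  exact heq_of_eq (Quot.sound h)

end CornerExpr

open CornerExpr in
/-- The free cornering of a strict monoidal category: the single object double category freely
generated by the arrows of `A` and the corner cells, subject to the equations above. -/
def freeCornering (A : Type u) [Category.{v} A] [MonoidalCategory A] [StrictMonoidal A] :
    SingleObjectDoubleCategory.{u, u, max u v} where
  H := A
  V := Exchange A
  monoidH := StrictMonoidal.objMonoid A
  Cell X S T Y := Quot (Rel (X := X) (Y := Y) (S := S) (T := T))
  hid X := Quot.mk _ (hid X)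
  vid S := Quot.mk _ (vid S)
  hcomp := Quot.map₂ hcomp (fun a _ _ h => Rel.hcomp_right a h) (fun _ _ b h => Rel.hcomp_left h b)
  vcomp := Quot.map₂ vcomp (fun a _ _ h => Rel.vcomp_right a h) (fun _ _ b h => Rel.vcomp_left h b)
  hcomp_assoc := by
    rintro _ _ _ _ _ _ _ _ _ _ ⟨a⟩ ⟨b⟩ ⟨c⟩
    exact mk_heq_of_rel_recast _ _ _ _ (Rel.hcomp_assoc a b c)
  hid_hcomp := by
    rintro _ _ _ _ ⟨a⟩
    exact mk_heq_of_rel_recast _ _ _ _ (Rel.hid_hcomp a)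
  hcomp_hid := by
    rintro _ _ _ _ ⟨a⟩
    exact mk_heq_of_rel_recast _ _ _ _ (Rel.hcomp_hid a)
  vcomp_assoc := by
    rintro _ _ _ _ _ _ _ _ _ _ ⟨a⟩ ⟨b⟩ ⟨c⟩
    exact mk_heq_of_rel_recast _ _ _ _ (Rel.vcomp_assoc a b c)
  vid_vcomp := by
    rintro _ _ _ _ ⟨a⟩
    exact mk_heq_of_rel_recast _ _ _ _ (Rel.vid_vcomp a)
  vcomp_vid := by
    rintro _ _ _ _ ⟨a⟩
    exact mk_heq_of_rel_recast _ _ _ _ (Rel.vcomp_vid a)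
  hid_mul X Y := Quot.sound (Rel.hid_mul X Y)
  vid_mul S T := Quot.sound (Rel.vid_tensor S T)
  hid_one := Quot.sound Rel.hid_one
  interchange := by
    rintro _ _ _ _ _ _ _ _ _ _ _ _ ⟨a⟩ ⟨b⟩ ⟨c⟩ ⟨d⟩
    exact Quot.sound (Rel.interchange a b c d)

/-! ### Optics as cells -/

section

variable {A : Type u} [Category.{v} A] [MonoidalCategory A] [StrictMonoidal A]

/-- The object `P° ⊗ Q•` of the category of horizontal cells of the free cornering. -/
def circBullet (P Q : A) : HorizontalCells (freeCornering A) := ⟨(circ P * bullet Q : Exchange A)⟩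

variable (A) in
/-- The horizontal cells of the free cornering between objects of the form `P° ⊗ Q•`: the
property that cuts out the full subcategory. -/
def isCircBullet : ObjectProperty (HorizontalCells (freeCornering A)) :=
  fun X => ∃ P Q : A, X = circBullet P Q

/-- `P° ⊗ Q•` as an object of the full subcategory. -/
def circBulletObj (X : Optic A) : (isCircBullet A).FullSubcategory :=
  ⟨circBullet X.fst X.snd, X.fst, X.snd, rfl⟩

open CornerExpr in
/-- The formal composite that represents `⟨α ∣ β⟩_M`. From top to bottom: receive `P` on the left,
apply `α`, send `C` away on the right, receive `D` on the right, apply `β`, send `Q` away on the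
left; the residual `M` stays in the middle. -/
def opticExpr {P Q C D : A} (M : A) (α : P ⟶ M ⊗ C) (β : M ⊗ D ⟶ Q) :
    CornerExpr A (circ P * bullet Q) (𝟙_ A) (𝟙_ A) (circ C * bullet D) :=
  recast (by simp only [one_mul]) rfl rfl (by simp only [one_mul, mul_one]) <|
    vcomp (circL P) <| vcomp (gen α) <| vcomp (hcomp (vid M) (circR C)) <|
    vcomp (hcomp (vid M) (bulletR D)) <| vcomp (gen β) (bulletL Q)

/-- The horizontal cell of the free cornering that corresponds to `⟨α ∣ β⟩_M`. -/
def opticCell {P Q C D : A} (M : A) (α : P ⟶ M ⊗ C) (β : M ⊗ D ⟶ Q) :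
    circBullet P Q ⟶ circBullet C D :=
  Quot.mk _ (opticExpr M α β)

/-- The same cell as an arrow of the full subcategory. -/
def opticCellHom {X Y : Optic A} (M : A) (α : X.fst ⟶ M ⊗ Y.fst) (β : M ⊗ Y.snd ⟶ X.snd) :
    circBulletObj X ⟶ circBulletObj Y :=
  ObjectProperty.homMk (opticCell M α β)

end

/-! The assignment `⟨α ∣ β⟩_M ↦ [α ∣ β]_M` respects sliding by interchange and respects identities
and composition by yanking. What remains is that it is bijective on arrows, and everything rests on
one universal cell: `exchangeR P Q`, with trivial left boundary, which sends `P` and then receives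
`Q` on the right. Horizontal composition with it is inverse to `bend`, which attaches the corners
`(P°; I; P; I)` and `(Q•; Q; I; I)`; the two directions are the two yanking equations. Hence cells
`(P° ⊗ Q•; I; I; Y)` are the same as cells `(I; P; Q; Y)`, and `[α ∣ β]_M` is the bend of a core
made of `α`, `exchangeR C D` beside `M`, and `β`.

Fullness is a normal form theorem. A cell with trivial left boundary is normal if it reads the word
on its right boundary letter by letter, sending objects for `∘` and receiving them for `•`, with
arrows in between. Normal cells are closed under composition with any cell on their right
(`IsNormal.hcomp`, by induction on formal composites). Since `exchangeR P Q` is normal, so is its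
composite with any `x : P° ⊗ Q• ⟶ C° ⊗ D•`, and a normal cell over the word `C° D•` is exactly the
core of an optic.

Faithfulness needs an invariant. The free cornering is interpreted in the squares of endofunctors of
the presheaf category of `A`: an object `S` acts as a horizontal edge by restriction along `- ⊗ S`,
the letter `P•` by the same restriction, and `P°` by its left adjoint, the left Kan extension. The
corners of `P°` are the unit and counit, and yanking becomes the triangle identities. A cell `P° ⊗
Q• ⟶ C° ⊗ D•` becomes a transformation `Lan_P Res_Q ⟶ Lan_C Res_D`. The coend formula for `Lan_C
Res_D` at the presheaf represented by `Q` gives precisely the optics into `(C, D)`, so following the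
universal element recovers the class of `(α, β)` from `[α ∣ β]_M`
(`opticOfTransformation_opticTransformation`). The proof uses only a map from this Kan extension to
the presheaf of optics, not that it is invertible. -/

/-! ### Equality of cells across propositionally equal boundaries -/

namespace SingleObjectDoubleCategory

variable {𝔻 : SingleObjectDoubleCategory.{w₁, w₂, w₃}}

/-- Two cells are equal, together with their boundaries. -/
inductive CellEq {X Y : 𝔻.V} {S T : 𝔻.H} (a : 𝔻.Cell X S T Y) :
    ∀ {X' Y' : 𝔻.V} {S' T' : 𝔻.H}, 𝔻.Cell X' S' T' Y' → Prop
  | refl : CellEq a a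

namespace CellEq

variable {X Y Z X' Y' Z' X₁ Y₁ Z₁ X₁' Y₁' Z₁' : 𝔻.V} {S T U S' T' U' S₁ T₁ U₁ S₁' T₁' : 𝔻.H}

theorem of_eq {a b : 𝔻.Cell X S T Y} (h : a = b) : CellEq a b := h ▸ .refl

/-- Heterogeneous equality alone does not identify the boundaries, so their equations are supplied
separately, in practice by the monoid laws. Once they are recorded, `CellEq` is a congruence for
both compositions and no transports are needed. -/
theorem of_heq {a : 𝔻.Cell X S T Y} {b : 𝔻.Cell X' S' T' Y'} (hX : X = X') (hS : S = S')
    (hT : T = T') (hY : Y = Y') (h : a ≍ b) : CellEq a b := by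
  subst hX hS hT hY
  exact of_eq (eq_of_heq h)

theorem heq {a : 𝔻.Cell X S T Y} {b : 𝔻.Cell X' S' T' Y'} (h : CellEq a b) : a ≍ b := by
  cases h
  rfl

theorem eq {a b : 𝔻.Cell X S T Y} (h : CellEq a b) : a = b := eq_of_heq h.heq

theorem top_eq {a : 𝔻.Cell X S T Y} {b : 𝔻.Cell X' S' T' Y'} (h : CellEq a b) : S = S' := by
  cases h
  rfl

theorem bottom_eq {a : 𝔻.Cell X S T Y} {b : 𝔻.Cell X' S' T' Y'} (h : CellEq a b) :
    T = T' := by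
  cases h
  rfl

theorem symm {a : 𝔻.Cell X S T Y} {b : 𝔻.Cell X' S' T' Y'} (h : CellEq a b) : CellEq b a := by
  cases h
  exact .refl

theorem trans {a : 𝔻.Cell X S T Y} {b : 𝔻.Cell X' S' T' Y'} {c : 𝔻.Cell X₁ S₁ T₁ Y₁}
    (h : CellEq a b) (h' : CellEq b c) : CellEq a c := by
  cases h
  exact h'

theorem hcomp {a : 𝔻.Cell X S T Y} {b : 𝔻.Cell Y S' T' Z} {a₁ : 𝔻.Cell X₁ S₁ T₁ Y₁}
    {b₁ : 𝔻.Cell Y₁ S₁' T₁' Z₁} (ha : CellEq a a₁) (hb : CellEq b b₁) :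
    CellEq (𝔻.hcomp a b) (𝔻.hcomp a₁ b₁) := by
  cases ha
  cases hb
  exact .refl

theorem vcomp {a : 𝔻.Cell X S T Y} {b : 𝔻.Cell X' T U Y'} {a₁ : 𝔻.Cell X₁ S₁ T₁ Y₁}
    {b₁ : 𝔻.Cell X₁' T₁ U₁ Y₁'} (ha : CellEq a a₁) (hb : CellEq b b₁) :
    CellEq (𝔻.vcomp a b) (𝔻.vcomp a₁ b₁) := by
  cases ha
  cases hb
  exact .refl

end CellEq

variable {X Y Z W X' Y' Z' X'' Y'' : 𝔻.V} {S T U R S' T' U' R' S'' T'' : 𝔻.H}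

theorem hcomp_assoc_cellEq (a : 𝔻.Cell X S T Y) (b : 𝔻.Cell Y S' T' Z)
    (c : 𝔻.Cell Z S'' T'' W) :
    CellEq (𝔻.hcomp (𝔻.hcomp a b) c) (𝔻.hcomp a (𝔻.hcomp b c)) :=
  .of_heq rfl (mul_assoc _ _ _) (mul_assoc _ _ _) rfl (𝔻.hcomp_assoc a b c)

theorem hid_hcomp_cellEq (a : 𝔻.Cell X S T Y) : CellEq (𝔻.hcomp (𝔻.hid X) a) a :=
  .of_heq rfl (one_mul _) (one_mul _) rfl (𝔻.hid_hcomp a)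

theorem hcomp_hid_cellEq (a : 𝔻.Cell X S T Y) : CellEq (𝔻.hcomp a (𝔻.hid Y)) a :=
  .of_heq rfl (mul_one _) (mul_one _) rfl (𝔻.hcomp_hid a)

theorem vcomp_assoc_cellEq (a : 𝔻.Cell X S T Y) (b : 𝔻.Cell X' T U Y')
    (c : 𝔻.Cell X'' U R Y'') :
    CellEq (𝔻.vcomp (𝔻.vcomp a b) c) (𝔻.vcomp a (𝔻.vcomp b c)) :=
  .of_heq (mul_assoc _ _ _) rfl rfl (mul_assoc _ _ _) (𝔻.vcomp_assoc a b c)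

theorem vid_vcomp_cellEq (a : 𝔻.Cell X S T Y) : CellEq (𝔻.vcomp (𝔻.vid S) a) a :=
  .of_heq (one_mul _) rfl rfl (one_mul _) (𝔻.vid_vcomp a)

theorem vcomp_vid_cellEq (a : 𝔻.Cell X S T Y) : CellEq (𝔻.vcomp a (𝔻.vid T)) a :=
  .of_heq (mul_one _) rfl rfl (mul_one _) (𝔻.vcomp_vid a)

theorem vid_one_hcomp_cellEq (a : 𝔻.Cell 1 S T Y) : CellEq (𝔻.hcomp (𝔻.vid 1) a) a := by
  rw [← 𝔻.hid_one]
  exact hid_hcomp_cellEq a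

theorem hcomp_vid_one_cellEq (a : 𝔻.Cell X S T 1) : CellEq (𝔻.hcomp a (𝔻.vid 1)) a := by
  rw [← 𝔻.hid_one]
  exact hcomp_hid_cellEq a

theorem vid_hcomp_vid_hcomp_cellEq (a : 𝔻.Cell 1 S'' T'' Y) :
    CellEq (𝔻.hcomp (𝔻.vid S) (𝔻.hcomp (𝔻.vid S') a)) (𝔻.hcomp (𝔻.vid (S * S')) a) := by
  rw [← 𝔻.vid_mul]
  exact (hcomp_assoc_cellEq _ _ _).symm

theorem interchange_cellEq (a : 𝔻.Cell X S T Y) (b : 𝔻.Cell X' T U Y') (c : 𝔻.Cell Y S' T' Z)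
    (d : 𝔻.Cell Y' T' U' Z') :
    CellEq (𝔻.hcomp (𝔻.vcomp a b) (𝔻.vcomp c d)) (𝔻.vcomp (𝔻.hcomp a c) (𝔻.hcomp b d)) :=
  .of_eq (𝔻.interchange a b c d)

/-- Change of boundaries of a cell. -/
def castCell (hX : X = X') (hS : S = S') (hT : T = T') (hY : Y = Y') (a : 𝔻.Cell X S T Y) :
    𝔻.Cell X' S' T' Y' :=
  cast (by rw [hX, hS, hT, hY]) a

theorem castCell_cellEq (hX : X = X') (hS : S = S') (hT : T = T') (hY : Y = Y')
    (a : 𝔻.Cell X S T Y) : CellEq (𝔻.castCell hX hS hT hY a) a := by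
  subst hX hS hT hY
  exact .refl

/-- A cell without top and bottom boundary, beside the middle of a vertical composite, composes
with the middle. -/
theorem hcomp_cellEq_of_sandwich {a : 𝔻.Cell X S T 1} {m : 𝔻.Cell X' T U Y}
    {b : 𝔻.Cell X'' U R 1} {x : 𝔻.Cell W S' R' Y} {y : 𝔻.Cell Y 1 1 Z}
    {n : 𝔻.Cell X' T U Z} (hx : CellEq x (𝔻.vcomp a (𝔻.vcomp m b)))
    (hn : CellEq (𝔻.hcomp m y) n) :
    CellEq (𝔻.hcomp x y) (𝔻.vcomp a (𝔻.vcomp n b)) := by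
  have hy : CellEq y (𝔻.vcomp (𝔻.vid 1) (𝔻.vcomp y (𝔻.vid 1))) :=
    ((vid_vcomp_cellEq _).trans (vcomp_vid_cellEq _)).symm
  refine (hx.hcomp hy).trans ?_
  rw [𝔻.interchange, 𝔻.interchange]
  exact (hcomp_vid_one_cellEq a).vcomp (hn.vcomp (hcomp_vid_one_cellEq b))

/-- Whiskering by a horizontal edge distributes over vertical composition. -/
theorem vid_hcomp_cellEq_vcomp {a : 𝔻.Cell 1 S T Y} {b : 𝔻.Cell 1 T U Y'}
    {c : 𝔻.Cell 1 S' U' Z} (hc : CellEq c (𝔻.vcomp a b)) :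
    CellEq (𝔻.hcomp (𝔻.vid R) c)
      (𝔻.vcomp (𝔻.hcomp (𝔻.vid R) a) (𝔻.hcomp (𝔻.vid R) b)) := by
  rw [← 𝔻.interchange]
  exact (vid_vcomp_cellEq (𝔻.vid R)).symm.hcomp hc

end SingleObjectDoubleCategory

/-! ### Generators and relations as equations between cells -/

namespace FreeCornering

open SingleObjectDoubleCategory

variable {A : Type u} [Category.{v} A] [MonoidalCategory A] [StrictMonoidal A]

/-- Cells of the free cornering. -/
abbrev FCell (X : Exchange A) (S T : A) (Y : Exchange A) : Type (max u v) :=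
  (freeCornering A).Cell X S T Y

/-- The cell of the free cornering given by an arrow. -/
def gen {P Q : A} (f : P ⟶ Q) : FCell 1 P Q 1 := Quot.mk _ (.gen f)

/-- The corner that sends an object away along the right boundary. -/
def circR (P : A) : FCell 1 P (𝟙_ A) (circ P) := Quot.mk _ (.circR P)

/-- The corner that receives an object along the left boundary. -/
def circL (P : A) : FCell (circ P) (𝟙_ A) P 1 := Quot.mk _ (.circL P)

/-- The corner that receives an object along the right boundary. -/
def bulletR (P : A) : FCell 1 (𝟙_ A) P (bullet P) := Quot.mk _ (.bulletR P)

/-- The corner that sends an object away along the left boundary. -/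
def bulletL (P : A) : FCell (bullet P) P (𝟙_ A) 1 := Quot.mk _ (.bulletL P)

/-- The cell represented by a formal composite. -/
def ofExpr {X Y : Exchange A} {S T : A} (a : CornerExpr A X S T Y) : FCell X S T Y := Quot.mk _ a

theorem gen_id_cellEq (P : A) : CellEq (gen (𝟙 P)) ((freeCornering A).vid P) :=
  .of_eq (Quot.sound (.gen_id P))

theorem gen_vcomp_gen_cellEq {P Q R : A} (f : P ⟶ Q) (g : Q ⟶ R) :
    CellEq ((freeCornering A).vcomp (gen f) (gen g)) (gen (f ≫ g)) :=
  .of_heq (mul_one _) rfl rfl (mul_one _) (CornerExpr.mk_heq_of_rel_recast _ _ _ _ (.gen_comp f g))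

theorem gen_hcomp_gen_cellEq {P Q P' Q' : A} (f : P ⟶ Q) (g : P' ⟶ Q') :
    CellEq ((freeCornering A).hcomp (gen f) (gen g)) (gen (f ⊗ₘ g)) :=
  .of_eq (Quot.sound (.gen_tensor f g))

theorem circR_hcomp_circL_cellEq (P : A) :
    CellEq ((freeCornering A).hcomp (circR P) (circL P)) ((freeCornering A).vid P) :=
  .of_heq rfl (mul_one _) (one_mul _) rfl
    (CornerExpr.mk_heq_of_rel_recast _ _ _ _ (.circ_yank_h P))

theorem circL_vcomp_circR_cellEq (P : A) :
    CellEq ((freeCornering A).vcomp (circL P) (circR P)) ((freeCornering A).hid (circ P)) :=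
  .of_heq (mul_one _) rfl rfl (one_mul _)
    (CornerExpr.mk_heq_of_rel_recast _ _ _ _ (.circ_yank_v P))

theorem bulletR_hcomp_bulletL_cellEq (P : A) :
    CellEq ((freeCornering A).hcomp (bulletR P) (bulletL P)) ((freeCornering A).vid P) :=
  .of_heq rfl (one_mul _) (mul_one _) rfl
    (CornerExpr.mk_heq_of_rel_recast _ _ _ _ (.bullet_yank_h P))

theorem bulletR_vcomp_bulletL_cellEq (P : A) :
    CellEq ((freeCornering A).vcomp (bulletR P) (bulletL P)) ((freeCornering A).hid (bullet P)) :=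
  .of_heq (one_mul _) rfl rfl (mul_one _)
    (CornerExpr.mk_heq_of_rel_recast _ _ _ _ (.bullet_yank_v P))

/-- By strictness the unitors and associators are of the form `eqToHom`; this lemma and the next two
let them disappear from cells. -/
theorem gen_eqToHom_cellEq {P Q : A} (h : P = Q) :
    CellEq (gen (eqToHom h)) ((freeCornering A).vid P) := by
  subst h
  exact gen_id_cellEq _

theorem gen_comp_eqToHom_cellEq {P Q R : A} (f : P ⟶ Q) (h : Q = R) :
    CellEq (gen (f ≫ eqToHom h)) (gen f) := by
  subst h
  simpa using CellEq.refl

theorem gen_eqToHom_comp_cellEq {P Q R : A} (h : P = Q) (f : Q ⟶ R) :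
    CellEq (gen (eqToHom h ≫ f)) (gen f) := by
  subst h
  simpa using CellEq.refl

theorem gen_leftUnitor_inv_cellEq (P : A) :
    CellEq (gen (λ_ P).inv) ((freeCornering A).vid P) := by
  rw [StrictMonoidal.leftUnitor_eq]
  exact gen_eqToHom_cellEq (StrictMonoidal.unit_tensor P).symm

theorem gen_leftUnitor_hom_cellEq (P : A) :
    CellEq (gen (λ_ P).hom) ((freeCornering A).vid P) := by
  rw [StrictMonoidal.leftUnitor_eq]
  refine (gen_eqToHom_cellEq (StrictMonoidal.unit_tensor P)).trans ?_
  rw [StrictMonoidal.unit_tensor]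
  exact .refl

theorem gen_vcomp_gen_vcomp_cellEq {P Q R T : A} {X Y : Exchange A} (f : P ⟶ Q) (g : Q ⟶ R)
    (c : FCell X R T Y) :
    CellEq ((freeCornering A).vcomp (gen f) ((freeCornering A).vcomp (gen g) c))
      ((freeCornering A).vcomp (gen (f ≫ g)) c) :=
  (vcomp_assoc_cellEq _ _ _).symm.trans ((gen_vcomp_gen_cellEq f g).vcomp .refl)

theorem vid_hcomp_gen_cellEq (M : A) {P Q : A} (f : P ⟶ Q) :
    CellEq ((freeCornering A).hcomp ((freeCornering A).vid M) (gen f)) (gen (M ◁ f)) := by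
  rw [← id_tensorHom]
  exact ((gen_id_cellEq M).symm.hcomp .refl).trans (gen_hcomp_gen_cellEq _ _)

theorem gen_hcomp_vid_cellEq {P Q : A} (f : P ⟶ Q) (M : A) :
    CellEq ((freeCornering A).hcomp (gen f) ((freeCornering A).vid M)) (gen (f ▷ M)) := by
  rw [← tensorHom_id]
  exact (CellEq.hcomp .refl (gen_id_cellEq M).symm).trans (gen_hcomp_gen_cellEq _ _)

/-! ### The universal cell with right boundary `P° ⊗ Q•` -/

/-- The cell that sends `P` away and then receives `Q`, along the right boundary. -/
def exchangeR (P Q : A) : FCell 1 P Q (circ P * bullet Q) :=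
  castCell (mul_one _) rfl rfl rfl ((freeCornering A).vcomp (circR P) (bulletR Q))

theorem exchangeR_cellEq (P Q : A) :
    CellEq (exchangeR P Q) ((freeCornering A).vcomp (circR P) (bulletR Q)) :=
  castCell_cellEq _ _ _ _ _

/-- The cell obtained from a cell with trivial left boundary by bending its top and bottom
boundaries to the left. -/
def bend {P Q : A} {Y : Exchange A} (m : FCell 1 P Q Y) :
    FCell (circ P * bullet Q) (𝟙_ A) (𝟙_ A) Y :=
  castCell (congrArg _ (one_mul _)) rfl rfl ((one_mul _).trans (mul_one _))
    ((freeCornering A).vcomp (circL P) ((freeCornering A).vcomp m (bulletL Q)))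

theorem bend_cellEq {P Q : A} {Y : Exchange A} (m : FCell 1 P Q Y) :
    CellEq (bend m)
      ((freeCornering A).vcomp (circL P) ((freeCornering A).vcomp m (bulletL Q))) :=
  castCell_cellEq _ _ _ _ _

/-- Vertical yanking, once for `P°` and once for `Q•`. With `exchangeR_hcomp_bend_cellEq`, which is
horizontal yanking, it makes bending a bijection. -/
theorem bend_exchangeR_cellEq (P Q : A) :
    CellEq (bend (exchangeR P Q)) ((freeCornering A).hid (circ P * bullet Q : Exchange A)) := by
  refine (bend_cellEq _).trans ?_
  refine (CellEq.vcomp .refl (((exchangeR_cellEq P Q).vcomp .refl).trans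
    (vcomp_assoc_cellEq _ _ _))).trans ?_
  refine (vcomp_assoc_cellEq _ _ _).symm.trans ?_
  refine ((circL_vcomp_circR_cellEq P).vcomp (bulletR_vcomp_bulletL_cellEq Q)).trans ?_
  exact .of_eq ((freeCornering A).hid_mul _ _)

theorem bend_hcomp_cellEq {P Q : A} {Y Z : Exchange A} {m : FCell 1 P Q Y}
    {y : FCell Y (𝟙_ A) (𝟙_ A) Z} {n : FCell 1 P Q Z}
    (hn : CellEq ((freeCornering A).hcomp m y) n) :
    CellEq ((freeCornering A).hcomp (bend m) y) (bend n) :=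
  (hcomp_cellEq_of_sandwich (bend_cellEq m) hn).trans (bend_cellEq n).symm

theorem exchangeR_hcomp_bend_cellEq {P Q : A} {Y : Exchange A} (m : FCell 1 P Q Y) :
    CellEq ((freeCornering A).hcomp (exchangeR P Q) (bend m)) m := by
  have h : CellEq (exchangeR P Q) ((freeCornering A).vcomp (circR P)
      ((freeCornering A).vcomp ((freeCornering A).vid 1) (bulletR Q))) :=
    (exchangeR_cellEq P Q).trans (CellEq.vcomp .refl (vid_vcomp_cellEq _).symm)
  refine (h.hcomp (bend_cellEq m)).trans ?_
  refine (interchange_cellEq _ _ _ _).trans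
    (CellEq.trans (CellEq.vcomp .refl (interchange_cellEq _ _ _ _)) ?_)
  refine ((circR_hcomp_circL_cellEq P).vcomp
    ((vid_one_hcomp_cellEq m).vcomp (bulletR_hcomp_bulletL_cellEq Q))).trans ?_
  exact (vid_vcomp_cellEq _).trans (vcomp_vid_cellEq _)

/-! ### The cells given by optics -/

/-- The cell with trivial left boundary that is given by an optic. -/
def opticCore {P Q C D : A} (M : A) (α : P ⟶ M ⊗ C) (β : M ⊗ D ⟶ Q) :
    FCell 1 P Q (circ C * bullet D) :=
  castCell ((one_mul _).trans (one_mul _)) rfl rfl ((one_mul _).trans (mul_one _))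
    ((freeCornering A).vcomp (gen α) ((freeCornering A).vcomp
      ((freeCornering A).hcomp ((freeCornering A).vid M) (exchangeR C D)) (gen β)))

theorem opticCore_cellEq {P Q C D : A} (M : A) (α : P ⟶ M ⊗ C) (β : M ⊗ D ⟶ Q) :
    CellEq (opticCore M α β) ((freeCornering A).vcomp (gen α) ((freeCornering A).vcomp
      ((freeCornering A).hcomp ((freeCornering A).vid M) (exchangeR C D)) (gen β))) :=
  castCell_cellEq _ _ _ _ _

theorem mk_recast_cellEq {X X' Y Y' : Exchange A} {S S' T T' : A} (hX : X = X') (hS : S = S')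
    (hT : T = T') (hY : Y = Y') (a : CornerExpr A X S T Y) :
    CellEq (𝔻 := freeCornering A) (X := X') (S := S') (T := T') (Y := Y')
      (Quot.mk _ (CornerExpr.recast hX hS hT hY a))
      (ofExpr a) := by
  subst hX hS hT hY
  exact .refl

/-- Reduces equations between optic cells to equations between their cores, where the left boundary
is trivial. -/
theorem opticCell_cellEq_bend {P Q C D : A} (M : A) (α : P ⟶ M ⊗ C) (β : M ⊗ D ⟶ Q) :
    CellEq (𝔻 := freeCornering A) (opticCell M α β) (bend (opticCore M α β)) := by
  refine CellEq.trans (mk_recast_cellEq _ _ _ _ _) (CellEq.symm ?_)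
  refine (bend_cellEq _).trans ?_
  refine CellEq.trans (b := (freeCornering A).vcomp (circL P) ((freeCornering A).vcomp (gen α)
    ((freeCornering A).vcomp
      ((freeCornering A).hcomp ((freeCornering A).vid M) (circR C))
    ((freeCornering A).vcomp ((freeCornering A).hcomp ((freeCornering A).vid M) (bulletR D))
    ((freeCornering A).vcomp (gen β) (bulletL Q)))))) ?_ .refl
  refine CellEq.vcomp .refl ?_
  refine ((opticCore_cellEq M α β).vcomp .refl).trans ?_
  refine (vcomp_assoc_cellEq _ _ _).trans (CellEq.vcomp .refl ?_)
  refine (vcomp_assoc_cellEq _ _ _).trans ?_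
  refine ((vid_hcomp_cellEq_vcomp (exchangeR_cellEq C D)).vcomp .refl).trans ?_
  exact vcomp_assoc_cellEq _ _ _

/-- By interchange both sides are `f` beside `exchangeR C D`: the residual does not take part in the
exchange. This is the geometric content of sliding. -/
theorem gen_vcomp_whisker_exchangeR_cellEq {M N : A} (f : M ⟶ N) (C D : A) :
    CellEq
      ((freeCornering A).vcomp (gen (f ▷ C))
        ((freeCornering A).hcomp ((freeCornering A).vid N) (exchangeR C D)))
      ((freeCornering A).vcomp
        ((freeCornering A).hcomp ((freeCornering A).vid M) (exchangeR C D)) (gen (f ▷ D))) := by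
  refine ((gen_hcomp_vid_cellEq f C).symm.vcomp .refl).trans ?_
  refine CellEq.trans ?_ (CellEq.vcomp .refl (gen_hcomp_vid_cellEq f D))
  refine (interchange_cellEq _ _ _ _).symm.trans (CellEq.trans ?_ (interchange_cellEq _ _ _ _))
  exact ((vcomp_vid_cellEq _).trans (vid_vcomp_cellEq _).symm).hcomp
    ((vid_vcomp_cellEq _).trans (vcomp_vid_cellEq _).symm)

theorem opticCore_slide {P Q C D M N : A} (f : M ⟶ N) (α : P ⟶ M ⊗ C) (β : N ⊗ D ⟶ Q) :
    opticCore N (α ≫ f ▷ C) β = opticCore M α (f ▷ D ≫ β) := by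
  refine CellEq.eq ?_
  refine (opticCore_cellEq _ _ _).trans (CellEq.trans ?_ (opticCore_cellEq M α (f ▷ D ≫ β)).symm)
  refine (gen_vcomp_gen_vcomp_cellEq _ _ _).symm.trans (CellEq.vcomp .refl ?_)
  refine (vcomp_assoc_cellEq _ _ _).symm.trans ?_
  refine ((gen_vcomp_whisker_exchangeR_cellEq f C D).vcomp .refl).trans ?_
  exact (vcomp_assoc_cellEq _ _ _).trans (CellEq.vcomp .refl (gen_vcomp_gen_cellEq (f ▷ D) β))

theorem opticCell_slide {P Q C D M N : A} (f : M ⟶ N) (α : P ⟶ M ⊗ C) (β : N ⊗ D ⟶ Q) :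
    opticCell N (α ≫ f ▷ C) β = opticCell M α (f ▷ D ≫ β) := by
  rw [(opticCell_cellEq_bend _ _ _).eq, (opticCell_cellEq_bend _ _ _).eq, opticCore_slide]

/-- With residual `I` and unitors for arrows, the core collapses to `exchangeR P Q`, whose bend is
the identity cell. -/
theorem opticCell_id (P Q : A) :
    opticCell (𝟙_ A) (λ_ P).inv (λ_ Q).hom = 𝟙 (circBullet P Q) := by
  refine CellEq.eq (𝔻 := freeCornering A) ((opticCell_cellEq_bend _ _ _).trans ?_)
  refine CellEq.trans (.of_eq ?_) (bend_exchangeR_cellEq P Q)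
  congr 1
  refine CellEq.eq ((opticCore_cellEq _ _ _).trans ?_)
  have hm : CellEq ((freeCornering A).hcomp ((freeCornering A).vid (𝟙_ A)) (exchangeR P Q))
    (exchangeR P Q) := vid_one_hcomp_cellEq (𝔻 := freeCornering A) _
  refine ((gen_leftUnitor_inv_cellEq P).vcomp (hm.vcomp (gen_leftUnitor_hom_cellEq Q))).trans ?_
  exact (vid_vcomp_cellEq _).trans (vcomp_vid_cellEq _)

theorem opticCore_hcomp_opticCell_cellEq {P Q C D E F : A} (M N : A) (α : P ⟶ M ⊗ C)
    (β : M ⊗ D ⟶ Q) (γ : C ⟶ N ⊗ E) (δ : N ⊗ F ⟶ D) :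
    CellEq ((freeCornering A).hcomp (opticCore M α β) (bend (opticCore N γ δ)))
      (opticCore (M ⊗ N) (α ≫ M ◁ γ ≫ (α_ M N E).inv) ((α_ M N F).hom ≫ M ◁ δ ≫ β)) := by
  -- The second cell meets only the middle layer of the first core, where `exchangeR C D` absorbs
  -- the bend and leaves the second core beside `M`.
  have hm : CellEq ((freeCornering A).hcomp
      ((freeCornering A).hcomp ((freeCornering A).vid M) (exchangeR C D)) (bend (opticCore N γ δ)))
      ((freeCornering A).hcomp ((freeCornering A).vid M) (opticCore N γ δ)) :=
    (hcomp_assoc_cellEq _ _ _).trans (CellEq.hcomp .refl (exchangeR_hcomp_bend_cellEq _))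
  refine (hcomp_cellEq_of_sandwich (opticCore_cellEq M α β)
    (n := show FCell 1 (M ⊗ C) (M ⊗ D) _ from
      (freeCornering A).hcomp ((freeCornering A).vid M) (opticCore N γ δ)) hm).trans ?_
  -- The second core without its top arrow `γ`. Whiskering by `M` can then be distributed over the
  -- layers one at a time, and `M ◁ γ` and `M ◁ δ` merge with `α` and `β`.
  let b : FCell 1 (N ⊗ E) D (circ E * bullet F) := castCell (one_mul _) rfl rfl (mul_one _)
    ((freeCornering A).vcomp ((freeCornering A).hcomp ((freeCornering A).vid N) (exchangeR E F))
      (gen δ))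
  have hb : CellEq b ((freeCornering A).vcomp
      ((freeCornering A).hcomp ((freeCornering A).vid N) (exchangeR E F)) (gen δ)) :=
    castCell_cellEq _ _ _ _ _
  have hγ : CellEq ((freeCornering A).hcomp ((freeCornering A).vid M) (gen γ))
      (gen (M ◁ γ ≫ (α_ M N E).inv)) := by
    rw [StrictMonoidal.associator_eq]
    exact (vid_hcomp_gen_cellEq M γ).trans
      (gen_comp_eqToHom_cellEq _ (StrictMonoidal.tensor_assoc M N E).symm).symm
  have hδ : CellEq ((freeCornering A).hcomp ((freeCornering A).vid M) (gen δ))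
      (gen ((α_ M N F).hom ≫ M ◁ δ)) := by
    rw [StrictMonoidal.associator_eq]
    exact (vid_hcomp_gen_cellEq M δ).trans
      (gen_eqToHom_comp_cellEq (StrictMonoidal.tensor_assoc M N F) _).symm
  have hMb : CellEq ((freeCornering A).hcomp ((freeCornering A).vid M) b)
      ((freeCornering A).vcomp ((freeCornering A).hcomp ((freeCornering A).vid (M ⊗ N : A))
        (exchangeR E F)) (gen ((α_ M N F).hom ≫ M ◁ δ))) :=
    (vid_hcomp_cellEq_vcomp hb).trans ((vid_hcomp_vid_hcomp_cellEq _).vcomp hδ)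
  have hcore : CellEq (opticCore N γ δ) ((freeCornering A).vcomp (gen γ) b) :=
    (opticCore_cellEq N γ δ).trans (CellEq.vcomp .refl hb.symm)
  have h := (vid_hcomp_cellEq_vcomp (R := (M : (freeCornering A).H)) hcore).trans (hγ.vcomp hMb)
  refine CellEq.trans (CellEq.vcomp .refl (h.vcomp .refl)) ?_
  refine CellEq.trans (CellEq.vcomp .refl (vcomp_assoc_cellEq _ _ _)) ?_
  refine (gen_vcomp_gen_vcomp_cellEq _ _ _).trans ?_
  refine CellEq.trans ?_ (opticCore_cellEq _ _ _).symm
  refine CellEq.vcomp .refl ((vcomp_assoc_cellEq _ _ _).trans (CellEq.vcomp .refl ?_))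
  have hβ := gen_vcomp_gen_cellEq ((α_ M N F).hom ≫ M ◁ δ) β
  rw [Category.assoc] at hβ
  exact hβ

/-- The cell of a composite of optics. -/
theorem opticCell_comp {P Q C D E F : A} (M N : A) (α : P ⟶ M ⊗ C) (β : M ⊗ D ⟶ Q)
    (γ : C ⟶ N ⊗ E) (δ : N ⊗ F ⟶ D) :
    opticCell (M ⊗ N) (α ≫ M ◁ γ ≫ (α_ M N E).inv) ((α_ M N F).hom ≫ M ◁ δ ≫ β) =
      opticCell M α β ≫ opticCell N γ δ := by
  refine CellEq.eq (𝔻 := freeCornering A) ?_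
  have h : CellEq (𝔻 := freeCornering A) (opticCell M α β ≫ opticCell N γ δ)
      ((freeCornering A).hcomp (opticCell M α β) (opticCell N γ δ)) :=
    .of_heq rfl (mul_one _).symm (mul_one _).symm rfl (HorizontalCells.comp_heq _ _)
  refine CellEq.trans ?_ h.symm
  refine (opticCell_cellEq_bend _ _ _).trans (CellEq.symm ?_)
  refine ((opticCell_cellEq_bend _ _ _).hcomp (opticCell_cellEq_bend _ _ _)).trans ?_
  exact bend_hcomp_cellEq (opticCore_hcomp_opticCell_cellEq M N α β γ δ)

/-! ### Normal forms -/

open FreeMonoid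

/-- The cell that sends the last factor of its top boundary away along the right boundary. -/
def send (K P : A) : FCell 1 (K ⊗ P) K (circ P) :=
  castCell rfl rfl (mul_one (M := (freeCornering A).H) K) rfl
    ((freeCornering A).hcomp ((freeCornering A).vid K) (circR P))

theorem send_cellEq (K P : A) :
    CellEq (send K P) ((freeCornering A).hcomp ((freeCornering A).vid K) (circR P)) :=
  castCell_cellEq _ _ _ _ _

/-- The cell that receives the last factor of its bottom boundary along the right boundary. -/
def receive (K P : A) : FCell 1 K (K ⊗ P) (bullet P) :=
  castCell rfl (mul_one (M := (freeCornering A).H) K) rfl rfl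
    ((freeCornering A).hcomp ((freeCornering A).vid K) (bulletR P))

theorem receive_cellEq (K P : A) :
    CellEq (receive K P) ((freeCornering A).hcomp ((freeCornering A).vid K) (bulletR P)) :=
  castCell_cellEq _ _ _ _ _

theorem gen_vcomp_receive_cellEq {M N : A} (f : M ⟶ N) (P : A) :
    CellEq ((freeCornering A).vcomp (gen f) (receive N P))
      ((freeCornering A).vcomp (receive M P) (gen (f ▷ P))) := by
  refine CellEq.trans ((hcomp_vid_one_cellEq (gen f)).symm.vcomp (receive_cellEq N P)) ?_
  refine CellEq.trans ?_ ((receive_cellEq M P).symm.vcomp (gen_hcomp_vid_cellEq f P))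
  refine (interchange_cellEq _ _ _ _).symm.trans (CellEq.trans ?_ (interchange_cellEq _ _ _ _))
  exact ((vcomp_vid_cellEq _).trans (vid_vcomp_cellEq _).symm).hcomp
    ((vid_vcomp_cellEq _).trans (vcomp_vid_cellEq _).symm)

/-- The normal cells with trivial left boundary: sequences of cells which, following the word on
the right boundary, send objects away (after applying an arrow) and receive objects, ending in an
arrow. -/
def IsNormal : ∀ (Y : List (A × Polarity)) {S T : A}, FCell 1 S T (ofList Y) → Prop
  | [], S, T, c => ∃ f : S ⟶ T, CellEq c (gen f)
  | (P, .circ) :: Y, S, T, c =>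
    ∃ (K : A) (α : S ⟶ K ⊗ P) (d : FCell 1 K T (ofList Y)), IsNormal Y d ∧
      CellEq c ((freeCornering A).vcomp (gen α) ((freeCornering A).vcomp (send K P) d))
  | (P, .bullet) :: Y, S, T, c =>
    ∃ d : FCell 1 (S ⊗ P) T (ofList Y), IsNormal Y d ∧
      CellEq c ((freeCornering A).vcomp (receive S P) d)

theorem IsNormal.congr {Y Y' : List (A × Polarity)} {S T S' T' : A}
    {c : FCell 1 S T (ofList Y)} {c' : FCell 1 S' T' (ofList Y')} (hc : IsNormal Y c)
    (hY : Y = Y') (h : CellEq c c') : IsNormal Y' c' := by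
  subst hY
  obtain rfl := h.top_eq
  obtain rfl := h.bottom_eq
  obtain rfl := h.eq
  exact hc

/-- A leading send already begins with an arrow, which absorbs `f`. A leading receive does not, so
`f` moves below it as `f ▷ P` and the induction continues. -/
theorem IsNormal.gen_vcomp {Y : List (A × Polarity)} {S S' T : A} {c : FCell 1 S T (ofList Y)}
    (hc : IsNormal Y c) (f : S' ⟶ S) {c' : FCell 1 S' T (ofList Y)}
    (h : CellEq c' ((freeCornering A).vcomp (gen f) c)) : IsNormal Y c' := by
  induction Y generalizing S S' with
  | nil =>
    obtain ⟨g, hg⟩ := hc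
    exact ⟨f ≫ g, h.trans ((CellEq.vcomp .refl hg).trans (gen_vcomp_gen_cellEq f g))⟩
  | cons y Y ih =>
    obtain ⟨P, _ | _⟩ := y
    · obtain ⟨K, α, d, hd, hcd⟩ := hc
      exact ⟨K, f ≫ α, d, hd,
        h.trans ((CellEq.vcomp .refl hcd).trans (gen_vcomp_gen_vcomp_cellEq _ _ _))⟩
    · obtain ⟨d, hd, hcd⟩ := hc
      refine ⟨castCell (one_mul _) rfl rfl (one_mul _)
        ((freeCornering A).vcomp (gen (f ▷ P)) d), ih hd _ (castCell_cellEq _ _ _ _ _), ?_⟩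
      refine (h.trans (CellEq.vcomp .refl hcd)).trans ?_
      refine (vcomp_assoc_cellEq _ _ _).symm.trans ?_
      refine ((gen_vcomp_receive_cellEq f P).vcomp .refl).trans ?_
      exact (vcomp_assoc_cellEq _ _ _).trans (CellEq.vcomp .refl (castCell_cellEq _ _ _ _ _).symm)

theorem IsNormal.vcomp {Y Y' : List (A × Polarity)} {S T U : A} {c : FCell 1 S T (ofList Y)}
    {c' : FCell 1 T U (ofList Y')} (hc : IsNormal Y c) (hc' : IsNormal Y' c')
    {d : FCell 1 S U (ofList (Y ++ Y'))} (h : CellEq d ((freeCornering A).vcomp c c')) :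
    IsNormal (Y ++ Y') d := by
  induction Y generalizing S with
  | nil =>
    obtain ⟨g, hg⟩ := hc
    exact hc'.gen_vcomp g (h.trans (hg.vcomp .refl))
  | cons y Y ih =>
    obtain ⟨P, _ | _⟩ := y
    · obtain ⟨K, α, e, he, hce⟩ := hc
      refine ⟨K, α, castCell (one_mul _) rfl rfl rfl ((freeCornering A).vcomp e c'),
        ih he (castCell_cellEq _ _ _ _ _), ?_⟩
      refine (h.trans (hce.vcomp .refl)).trans ?_
      refine (vcomp_assoc_cellEq _ _ _).trans (CellEq.vcomp .refl ?_)
      exact (vcomp_assoc_cellEq _ _ _).trans (CellEq.vcomp .refl (castCell_cellEq _ _ _ _ _).symm)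
    · obtain ⟨e, he, hce⟩ := hc
      refine ⟨castCell (one_mul _) rfl rfl rfl ((freeCornering A).vcomp e c'),
        ih he (castCell_cellEq _ _ _ _ _), ?_⟩
      refine (h.trans (hce.vcomp .refl)).trans ?_
      exact (vcomp_assoc_cellEq _ _ _).trans (CellEq.vcomp .refl (castCell_cellEq _ _ _ _ _).symm)

/-- A normal cell follows its boundary word, so it can be cut wherever the word is cut. This handles
vertical composites in `IsNormal.hcomp`. -/
theorem IsNormal.exists_vcomp (Y : List (A × Polarity)) {Y' : List (A × Polarity)} {S U : A}
    {d : FCell 1 S U (ofList (Y ++ Y'))} (hd : IsNormal (Y ++ Y') d) :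
    ∃ (T : A) (c : FCell 1 S T (ofList Y)) (c' : FCell 1 T U (ofList Y')),
      IsNormal Y c ∧ IsNormal Y' c' ∧ CellEq d ((freeCornering A).vcomp c c') := by
  induction Y generalizing S with
  | nil =>
    exact ⟨S, gen (𝟙 S), d, ⟨𝟙 S, .refl⟩, hd,
      (vid_vcomp_cellEq d).symm.trans ((gen_id_cellEq S).symm.vcomp .refl)⟩
  | cons y Y ih =>
    obtain ⟨P, _ | _⟩ := y
    · obtain ⟨K, α, e, he, hde⟩ := hd
      obtain ⟨T, c, c', hc, hc', hcc'⟩ := ih he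
      refine ⟨T, castCell ((one_mul _).trans (one_mul _)) rfl rfl (one_mul _)
        ((freeCornering A).vcomp (gen α) ((freeCornering A).vcomp (send K P) c)), c',
        ⟨K, α, c, hc, castCell_cellEq _ _ _ _ _⟩, hc', ?_⟩
      refine hde.trans (CellEq.trans (CellEq.vcomp .refl (CellEq.vcomp .refl hcc')) ?_)
      refine CellEq.trans ?_ ((castCell_cellEq _ _ _ _ _).symm.vcomp .refl)
      refine CellEq.trans ?_ (vcomp_assoc_cellEq _ _ _).symm
      exact CellEq.vcomp .refl (vcomp_assoc_cellEq _ _ _).symm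
    · obtain ⟨e, he, hde⟩ := hd
      obtain ⟨T, c, c', hc, hc', hcc'⟩ := ih he
      refine ⟨T, castCell (one_mul _) rfl rfl rfl
        ((freeCornering A).vcomp (receive S P) c), c',
        ⟨c, hc, castCell_cellEq _ _ _ _ _⟩, hc', ?_⟩
      refine hde.trans (CellEq.trans (CellEq.vcomp .refl hcc') ?_)
      refine CellEq.trans ?_ ((castCell_cellEq _ _ _ _ _).symm.vcomp .refl)
      exact (vcomp_assoc_cellEq _ _ _).symm

/-! ### Closure of normal cells under horizontal composition -/

theorem send_hcomp_circL_cellEq (K P : A) :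
    CellEq ((freeCornering A).hcomp (send K P) (circL P)) ((freeCornering A).vid (K ⊗ P : A)) := by
  refine ((send_cellEq K P).hcomp .refl).trans ((hcomp_assoc_cellEq _ _ _).trans ?_)
  exact (CellEq.hcomp .refl (circR_hcomp_circL_cellEq P)).trans
    (.of_eq ((freeCornering A).vid_mul _ _))

theorem receive_hcomp_bulletL_cellEq (K P : A) :
    CellEq ((freeCornering A).hcomp (receive K P) (bulletL P))
      ((freeCornering A).vid (K ⊗ P : A)) := by
  refine ((receive_cellEq K P).hcomp .refl).trans ((hcomp_assoc_cellEq _ _ _).trans ?_)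
  exact (CellEq.hcomp .refl (bulletR_hcomp_bulletL_cellEq P)).trans
    (.of_eq ((freeCornering A).vid_mul _ _))

theorem gen_rightUnitor_hom_comp_cellEq {P Q : A} (f : P ⟶ Q) :
    CellEq (gen ((ρ_ P).hom ≫ f)) (gen f) := by
  rw [StrictMonoidal.rightUnitor_eq]
  exact gen_eqToHom_comp_cellEq (StrictMonoidal.tensor_unit P) f

theorem gen_comp_rightUnitor_inv_cellEq {P Q : A} (f : P ⟶ Q) :
    CellEq (gen (f ≫ (ρ_ Q).inv)) (gen f) := by
  rw [StrictMonoidal.rightUnitor_eq]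
  exact gen_comp_eqToHom_cellEq f (StrictMonoidal.tensor_unit Q).symm

/-- By interchange `g` can be applied before the send, where the normal form allows an arrow. For
the `•`-corner below it goes after the receive instead. -/
theorem isNormal_gen_hcomp_circR {M N : A} (g : M ⟶ N) (P : A)
    {d : FCell 1 (M ⊗ P) (N ⊗ 𝟙_ A) (circ P)}
    (h : CellEq d ((freeCornering A).hcomp (gen g) (circR P))) :
    IsNormal (toList (circ P)) d := by
  refine ⟨N, g ▷ P, gen (𝟙 N ≫ (ρ_ N).inv), ⟨_, .refl⟩, h.trans ?_⟩
  refine ((vcomp_vid_cellEq (gen g)).symm.hcomp (vid_vcomp_cellEq (circR P)).symm).trans ?_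
  refine (interchange_cellEq _ _ _ _).trans ((gen_hcomp_vid_cellEq g P).vcomp ?_)
  refine (send_cellEq N P).symm.trans ((vcomp_vid_cellEq _).symm.trans (CellEq.vcomp .refl ?_))
  exact (gen_id_cellEq N).symm.trans (gen_comp_rightUnitor_inv_cellEq (𝟙 N)).symm

theorem isNormal_gen_hcomp_bulletR {M N : A} (g : M ⟶ N) (P : A)
    {d : FCell 1 (M ⊗ 𝟙_ A) (N ⊗ P) (bullet P)}
    (h : CellEq d ((freeCornering A).hcomp (gen g) (bulletR P))) :
    IsNormal (toList (bullet P)) d := by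
  refine ⟨gen (((ρ_ M).hom ≫ g) ▷ P), ⟨_, .refl⟩, h.trans ?_⟩
  refine ((gen_rightUnitor_hom_comp_cellEq g).symm.hcomp .refl).trans ?_
  refine ((vid_vcomp_cellEq _).symm.hcomp (vcomp_vid_cellEq (bulletR P)).symm).trans ?_
  exact (interchange_cellEq _ _ _ _).trans ((receive_cellEq _ P).symm.vcomp
    (gen_hcomp_vid_cellEq _ P))

/-- Normal cells are closed under composition with arbitrary cells on the right. -/
theorem IsNormal.hcomp {X Y : Exchange A} {S T : A} (a : CornerExpr A X S T Y) {M N : A}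
    {c : FCell 1 M N X} (hc : IsNormal (toList X) c) {d : FCell 1 (M ⊗ S) (N ⊗ T) Y}
    (h : CellEq d ((freeCornering A).hcomp c (ofExpr a))) :
    IsNormal (toList Y) d := by
  -- The top and bottom objects `M`, `N` must vary: the vertical case cuts `c` at a new intermediate
  -- object.
  induction a generalizing M N with
  | gen f =>
    obtain ⟨g, hg⟩ := hc
    exact ⟨g ⊗ₘ f, h.trans ((hg.hcomp .refl).trans (gen_hcomp_gen_cellEq g f))⟩
  | circR P =>
    obtain ⟨g, hg⟩ := hc
    exact isNormal_gen_hcomp_circR g P (h.trans (hg.hcomp .refl))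
  | circL P =>
    -- Over the word `P°` the cell `c` is `α`, then a send of `P`, then `g`. The corner cancels the
    -- send by yanking, and `P` passes beside `g`.
    obtain ⟨K, α, e, ⟨g, hg⟩, hc⟩ := hc
    refine ⟨_, h.trans ((hc.hcomp .refl).trans (CellEq.trans ?_
      (gen_rightUnitor_hom_comp_cellEq (α ≫ g ▷ P)).symm))⟩
    have hP : CellEq (circL P) ((freeCornering A).vcomp ((freeCornering A).vid 1)
        ((freeCornering A).vcomp (circL P) ((freeCornering A).vid P))) :=
      ((vid_vcomp_cellEq _).trans (vcomp_vid_cellEq _)).symm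
    refine (CellEq.hcomp (CellEq.vcomp .refl (CellEq.vcomp .refl hg)) hP).trans ?_
    refine (interchange_cellEq _ _ _ _).trans
      (CellEq.trans (CellEq.vcomp .refl (interchange_cellEq _ _ _ _)) ?_)
    refine (CellEq.vcomp (hcomp_vid_one_cellEq _) ((send_hcomp_circL_cellEq K P).vcomp
      (gen_hcomp_vid_cellEq g P))).trans ?_
    exact (CellEq.vcomp .refl (vid_vcomp_cellEq _)).trans (gen_vcomp_gen_cellEq _ _)
  | bulletR P =>
    obtain ⟨g, hg⟩ := hc
    exact isNormal_gen_hcomp_bulletR g P (h.trans (hg.hcomp .refl))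
  | bulletL P =>
    obtain ⟨e, ⟨g, hg⟩, hc⟩ := hc
    refine ⟨_, h.trans ((hc.hcomp .refl).trans (CellEq.trans ?_
      (gen_comp_rightUnitor_inv_cellEq g).symm))⟩
    refine (CellEq.hcomp (CellEq.vcomp .refl hg) (vcomp_vid_cellEq (bulletL P)).symm).trans ?_
    refine (interchange_cellEq _ _ _ _).trans ?_
    exact (CellEq.vcomp (receive_hcomp_bulletL_cellEq M P) (hcomp_vid_one_cellEq _)).trans
      (vid_vcomp_cellEq _)
  | hid X =>
    refine hc.congr rfl (h.trans (hcomp_hid_cellEq c)).symm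
  | vid S =>
    obtain ⟨g, hg⟩ := hc
    exact ⟨g ▷ S, h.trans ((hg.hcomp .refl).trans (gen_hcomp_vid_cellEq g S))⟩
  | hcomp a b iha ihb =>
    refine (ihb (iha hc .refl) .refl).congr rfl ((hcomp_assoc_cellEq _ _ _).trans h.symm)
  | @vcomp X Y X' Y' S T U a b iha ihb =>
    -- Cutting `c` where the left boundary passes from `a` to `b` makes interchange applicable.
    obtain ⟨K, e, e', he, he', hc'⟩ := IsNormal.exists_vcomp (toList X) hc
    exact (iha he .refl).vcomp (ihb he' .refl)
      (h.trans ((hc'.hcomp .refl).trans (interchange_cellEq e e' (ofExpr a) (ofExpr b))))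

theorem isNormal_exchangeR (P Q : A) :
    IsNormal (toList (circ P * bullet Q)) (exchangeR P Q) := by
  refine ⟨𝟙_ A, (λ_ P).inv, castCell rfl rfl rfl (mul_one _)
    ((freeCornering A).vcomp (receive (𝟙_ A) Q) (gen (λ_ Q).hom)),
    ⟨gen (λ_ Q).hom, ⟨_, .refl⟩, castCell_cellEq _ _ _ _ _⟩, ?_⟩
  refine (exchangeR_cellEq P Q).trans (CellEq.symm ?_)
  have hP : CellEq (send (𝟙_ A) P) (circR P) :=
    (send_cellEq _ _).trans (vid_one_hcomp_cellEq (𝔻 := freeCornering A) _)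
  have hQ : CellEq (receive (𝟙_ A) Q) (bulletR Q) :=
    (receive_cellEq _ _).trans (vid_one_hcomp_cellEq (𝔻 := freeCornering A) _)
  refine ((gen_leftUnitor_inv_cellEq P).vcomp (hP.vcomp ((castCell_cellEq _ _ _ _ _).trans
    (hQ.vcomp (gen_leftUnitor_hom_cellEq Q))))).trans ?_
  exact (vid_vcomp_cellEq _).trans (CellEq.vcomp .refl (vcomp_vid_cellEq _))

/-- Every cell with right boundary `C° ⊗ D•` and trivial left boundary is given by an optic. -/
theorem IsNormal.exists_eq_opticCore {P Q C D : A} {c : FCell 1 P Q (circ C * bullet D)}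
    (hc : IsNormal (toList (circ C * bullet D)) c) :
    ∃ (M : A) (α : P ⟶ M ⊗ C) (β : M ⊗ D ⟶ Q), c = opticCore M α β := by
  obtain ⟨M, α, d, ⟨e, ⟨β, hβ⟩, hd⟩, hc⟩ := hc
  refine ⟨M, α, β, CellEq.eq (hc.trans (CellEq.trans (CellEq.vcomp .refl ?_)
    (opticCore_cellEq M α β).symm))⟩
  refine (CellEq.vcomp .refl (hd.trans (CellEq.vcomp .refl hβ))).trans ?_
  refine (vcomp_assoc_cellEq _ _ _).symm.trans (CellEq.vcomp ?_ .refl)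
  exact ((send_cellEq M C).vcomp (receive_cellEq M D)).trans
    (vid_hcomp_cellEq_vcomp (exchangeR_cellEq C D)).symm

/-- Every horizontal cell from `P° ⊗ Q•` to `C° ⊗ D•` is given by an optic. -/
theorem exists_eq_opticCell {P Q C D : A} (x : circBullet P Q ⟶ circBullet C D) :
    ∃ (M : A) (α : P ⟶ M ⊗ C) (β : M ⊗ D ⟶ Q), x = opticCell M α β := by
  obtain ⟨a, rfl⟩ := Quot.exists_rep x
  -- Composing with the universal cell makes the left boundary trivial, so that normal forms apply.
  let c : FCell 1 P Q (circ C * bullet D) :=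
    castCell rfl (mul_one (M := (freeCornering A).H) P) (mul_one (M := (freeCornering A).H) Q) rfl
      ((freeCornering A).hcomp (exchangeR P Q) (Quot.mk _ a))
  have hc : CellEq ((freeCornering A).hcomp (exchangeR P Q) (Quot.mk _ a)) c :=
    (castCell_cellEq _ _ _ _ _).symm
  have hn : IsNormal (toList (circ C * bullet D)) c :=
    ((isNormal_exchangeR P Q).hcomp a .refl).congr rfl hc
  obtain ⟨M, α, β, h⟩ := hn.exists_eq_opticCore
  refine ⟨M, α, β, CellEq.eq (𝔻 := freeCornering A) ?_⟩
  refine CellEq.trans ?_ (opticCell_cellEq_bend M α β).symm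
  rw [← h]
  -- The identity is the bend of `exchangeR P Q`, so `x` is the bend of `c`.
  exact (hid_hcomp_cellEq _).symm.trans
    (((bend_exchangeR_cellEq P Q).symm.hcomp .refl).trans (bend_hcomp_cellEq hc))

end FreeCornering

/-! ### Quintets -/

section

variable (𝒞 : Type u) [Category.{v} 𝒞]

/-- The monoid of endofunctors of a category. -/
abbrev endofunctorMonoid : Monoid (𝒞 ⥤ 𝒞) where
  mul F G := G ⋙ F
  one := 𝟭 𝒞
  mul_assoc _ _ _ := rfl
  one_mul _ := rfl
  mul_one _ := rfl

/-- The double category of squares in the one-object 2-category of endofunctors of a category. -/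
def quintets : SingleObjectDoubleCategory where
  H := 𝒞 ⥤ 𝒞
  V := 𝒞 ⥤ 𝒞
  monoidH := endofunctorMonoid 𝒞
  monoidV := endofunctorMonoid 𝒞
  Cell X S T Y := T ⋙ X ⟶ Y ⋙ S
  hid X := 𝟙 X
  vid S := 𝟙 S
  hcomp {_ _ _ S _ _ T'} a b := Functor.whiskerLeft T' a ≫ Functor.whiskerRight b S
  vcomp {X _ _ Y' _ _ _} a b := Functor.whiskerRight b X ≫ Functor.whiskerLeft Y' a
  hcomp_assoc {_ _ _ _ S _ S' T' _ T''} a b c := by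
    refine heq_of_eq (NatTrans.ext (funext fun F => ?_))
    change (a.app (T'.obj (T''.obj F)) ≫ S.map (b.app (T''.obj F))) ≫ S.map (S'.map (c.app F)) =
      a.app (T'.obj (T''.obj F)) ≫ S.map (b.app (T''.obj F) ≫ S'.map (c.app F))
    rw [Functor.map_comp, Category.assoc]
  hid_hcomp a := by
    refine heq_of_eq (NatTrans.ext (funext fun F => ?_))
    exact Category.id_comp (a.app F)
  hcomp_hid {X Y S T} a := by
    refine heq_of_eq (NatTrans.ext (funext fun F => ?_))
    exact (congrArg (a.app F ≫ ·) (S.map_id _)).trans (Category.comp_id (a.app F))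
  vcomp_assoc {X _ X' Y' _ Y'' _ _ _ _} a b c := by
    refine heq_of_eq (NatTrans.ext (funext fun F => ?_))
    change X.map (X'.map (c.app F)) ≫ X.map (b.app (Y''.obj F)) ≫ a.app (Y'.obj (Y''.obj F)) =
      X.map (X'.map (c.app F) ≫ b.app (Y''.obj F)) ≫ a.app (Y'.obj (Y''.obj F))
    rw [Functor.map_comp, Category.assoc]
  vid_vcomp a := by
    refine heq_of_eq (NatTrans.ext (funext fun F => ?_))
    exact Category.comp_id (a.app F)
  vcomp_vid {X Y S T} a := by
    refine heq_of_eq (NatTrans.ext (funext fun F => ?_))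
    exact (congrArg (· ≫ a.app F) (X.map_id _)).trans (Category.id_comp (a.app F))
  hid_mul X Y := NatTrans.ext (funext fun F =>
    (congrArg (· ≫ _) (X.map_id _)).trans (Category.id_comp _))
  vid_mul S T := NatTrans.ext (funext fun F =>
    (congrArg (_ ≫ ·) (S.map_id _)).trans (Category.id_comp _))
  hid_one := rfl
  interchange {X Y _ _ Y' Z' S T _ _ T' U'} a b c d := by
    refine NatTrans.ext (funext fun F => ?_)
    change (X.map (b.app (U'.obj F)) ≫ a.app (Y'.obj (U'.obj F))) ≫
        S.map (Y.map (d.app F) ≫ c.app (Z'.obj F)) =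
      X.map (b.app (U'.obj F) ≫ T.map (d.app F)) ≫ a.app (T'.obj (Z'.obj F)) ≫
        S.map (c.app (Z'.obj F))
    -- Interchange reduces to functoriality and this naturality square.
    have h := a.naturality (d.app F)
    change X.map (T.map (d.app F)) ≫ a.app (T'.obj (Z'.obj F)) =
      a.app (Y'.obj (U'.obj F)) ≫ S.map (Y.map (d.app F)) at h
    rw [Functor.map_comp, Functor.map_comp, Category.assoc, Category.assoc]
    refine congrArg (_ ≫ ·) ?_
    exact (Category.assoc _ _ _).symm.trans ((congrArg (· ≫ _) h.symm).trans
      (Category.assoc _ _ _))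

end

/-! ### The universal property of the free cornering -/

open SingleObjectDoubleCategory in
/-- An interpretation of the generators of the free cornering in a double category with one
object. -/
structure CorneringModel (A : Type u) [Category.{v} A] [MonoidalCategory A]
    (𝔻 : SingleObjectDoubleCategory.{w₁, w₂, w₃}) where
  edgeH : A → 𝔻.H
  edgeV : Exchange A →* 𝔻.V
  edgeH_unit : edgeH (𝟙_ A) = 1
  edgeH_tensor (S T : A) : edgeH (S ⊗ T) = edgeH S * edgeH T
  gen {P Q : A} (f : P ⟶ Q) : 𝔻.Cell 1 (edgeH P) (edgeH Q) 1
  circR (P : A) : 𝔻.Cell 1 (edgeH P) 1 (edgeV (circ P))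
  circL (P : A) : 𝔻.Cell (edgeV (circ P)) 1 (edgeH P) 1
  bulletR (P : A) : 𝔻.Cell 1 1 (edgeH P) (edgeV (bullet P))
  bulletL (P : A) : 𝔻.Cell (edgeV (bullet P)) (edgeH P) 1 1
  gen_id (P : A) : gen (𝟙 P) = 𝔻.vid (edgeH P)
  gen_comp {P Q R : A} (f : P ⟶ Q) (g : Q ⟶ R) :
    CellEq (𝔻.vcomp (gen f) (gen g)) (gen (f ≫ g))
  gen_tensor {P Q P' Q' : A} (f : P ⟶ Q) (g : P' ⟶ Q') :
    CellEq (𝔻.hcomp (gen f) (gen g)) (gen (f ⊗ₘ g))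
  circ_yank_h (P : A) : CellEq (𝔻.hcomp (circR P) (circL P)) (𝔻.vid (edgeH P))
  circ_yank_v (P : A) : CellEq (𝔻.vcomp (circL P) (circR P)) (𝔻.hid (edgeV (circ P)))
  bullet_yank_h (P : A) : CellEq (𝔻.hcomp (bulletR P) (bulletL P)) (𝔻.vid (edgeH P))
  bullet_yank_v (P : A) : CellEq (𝔻.vcomp (bulletR P) (bulletL P)) (𝔻.hid (edgeV (bullet P)))

namespace CorneringModel

open SingleObjectDoubleCategory

variable {A : Type u} [Category.{v} A] [MonoidalCategory A]
  {𝔻 : SingleObjectDoubleCategory.{w₁, w₂, w₃}} (𝓜 : CorneringModel A 𝔻)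

/-- The interpretation of a formal composite. -/
def eval : ∀ {X Y : Exchange A} {S T : A}, CornerExpr A X S T Y →
    𝔻.Cell (𝓜.edgeV X) (𝓜.edgeH S) (𝓜.edgeH T) (𝓜.edgeV Y)
  | _, _, _, _, .gen f =>
    castCell (map_one 𝓜.edgeV).symm rfl rfl (map_one 𝓜.edgeV).symm (𝓜.gen f)
  | _, _, _, _, .circR P => castCell (map_one 𝓜.edgeV).symm rfl 𝓜.edgeH_unit.symm rfl (𝓜.circR P)
  | _, _, _, _, .circL P => castCell rfl 𝓜.edgeH_unit.symm rfl (map_one 𝓜.edgeV).symm (𝓜.circL P)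
  | _, _, _, _, .bulletR P =>
    castCell (map_one 𝓜.edgeV).symm 𝓜.edgeH_unit.symm rfl rfl (𝓜.bulletR P)
  | _, _, _, _, .bulletL P =>
    castCell rfl rfl 𝓜.edgeH_unit.symm (map_one 𝓜.edgeV).symm (𝓜.bulletL P)
  | _, _, _, _, .hid X => castCell rfl 𝓜.edgeH_unit.symm 𝓜.edgeH_unit.symm rfl (𝔻.hid (𝓜.edgeV X))
  | _, _, _, _, .vid S =>
    castCell (map_one 𝓜.edgeV).symm rfl rfl (map_one 𝓜.edgeV).symm (𝔻.vid (𝓜.edgeH S))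
  | _, _, _, _, .hcomp a b =>
    castCell rfl (𝓜.edgeH_tensor _ _).symm (𝓜.edgeH_tensor _ _).symm rfl
      (𝔻.hcomp (eval a) (eval b))
  | _, _, _, _, .vcomp a b =>
    castCell (map_mul 𝓜.edgeV _ _).symm rfl rfl (map_mul 𝓜.edgeV _ _).symm
      (𝔻.vcomp (eval a) (eval b))

variable {X Y Z X' Y' : Exchange A} {S T U S' T' : A}

theorem eval_gen {P Q : A} (f : P ⟶ Q) : CellEq (𝓜.eval (.gen f)) (𝓜.gen f) :=
  castCell_cellEq _ _ _ _ _

theorem eval_circR (P : A) : CellEq (𝓜.eval (.circR P)) (𝓜.circR P) := castCell_cellEq _ _ _ _ _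

theorem eval_circL (P : A) : CellEq (𝓜.eval (.circL P)) (𝓜.circL P) := castCell_cellEq _ _ _ _ _

theorem eval_bulletR (P : A) : CellEq (𝓜.eval (.bulletR P)) (𝓜.bulletR P) :=
  castCell_cellEq _ _ _ _ _

theorem eval_bulletL (P : A) : CellEq (𝓜.eval (.bulletL P)) (𝓜.bulletL P) :=
  castCell_cellEq _ _ _ _ _

theorem eval_hid (X : Exchange A) : CellEq (𝓜.eval (.hid X)) (𝔻.hid (𝓜.edgeV X)) :=
  castCell_cellEq _ _ _ _ _

theorem eval_vid (S : A) : CellEq (𝓜.eval (.vid S)) (𝔻.vid (𝓜.edgeH S)) :=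
  castCell_cellEq _ _ _ _ _

theorem eval_hcomp (a : CornerExpr A X S T Y) (b : CornerExpr A Y S' T' Z) :
    CellEq (𝓜.eval (.hcomp a b)) (𝔻.hcomp (𝓜.eval a) (𝓜.eval b)) :=
  castCell_cellEq _ _ _ _ _

theorem eval_vcomp (a : CornerExpr A X S T Y) (b : CornerExpr A X' T U Y') :
    CellEq (𝓜.eval (.vcomp a b)) (𝔻.vcomp (𝓜.eval a) (𝓜.eval b)) :=
  castCell_cellEq _ _ _ _ _

theorem eval_recast (hX : X = X') (hS : S = S') (hT : T = T') (hY : Y = Y')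
    (a : CornerExpr A X S T Y) :
    CellEq (𝓜.eval (CornerExpr.recast hX hS hT hY a)) (𝓜.eval a) := by
  subst hX hS hT hY
  exact .refl

theorem hid_congr {V W : 𝔻.V} (h : V = W) : CellEq (𝔻.hid V) (𝔻.hid W) := by
  subst h
  exact .refl

theorem vid_congr {V W : 𝔻.H} (h : V = W) : CellEq (𝔻.vid V) (𝔻.vid W) := by
  subst h
  exact .refl

/-- The interpretation respects the equations of the free cornering. -/
theorem eval_eq_of_rel [StrictMonoidal A] {a b : CornerExpr A X S T Y}
    (h : CornerExpr.Rel a b) : 𝓜.eval a = 𝓜.eval b := by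
  induction h with
  | hcomp_left h b ih =>
    exact ((𝓜.eval_hcomp _ _).trans (((CellEq.of_eq ih).hcomp .refl).trans
      (𝓜.eval_hcomp _ _).symm)).eq
  | hcomp_right a h ih =>
    exact ((𝓜.eval_hcomp _ _).trans ((CellEq.hcomp .refl (.of_eq ih)).trans
      (𝓜.eval_hcomp _ _).symm)).eq
  | vcomp_left h b ih =>
    exact ((𝓜.eval_vcomp _ _).trans (((CellEq.of_eq ih).vcomp .refl).trans
      (𝓜.eval_vcomp _ _).symm)).eq
  | vcomp_right a h ih =>
    exact ((𝓜.eval_vcomp _ _).trans ((CellEq.vcomp .refl (.of_eq ih)).trans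
      (𝓜.eval_vcomp _ _).symm)).eq
  | hcomp_assoc a b c =>
    refine CellEq.eq ((𝓜.eval_recast _ _ _ _ _).trans ?_)
    refine ((𝓜.eval_hcomp _ _).trans ((𝓜.eval_hcomp _ _).hcomp .refl)).trans ?_
    refine (hcomp_assoc_cellEq _ _ _).trans (CellEq.symm ?_)
    exact (𝓜.eval_hcomp _ _).trans (CellEq.hcomp .refl (𝓜.eval_hcomp _ _))
  | hid_hcomp a =>
    refine CellEq.eq ((𝓜.eval_recast _ _ _ _ _).trans ((𝓜.eval_hcomp _ _).trans ?_))
    exact ((𝓜.eval_hid _).hcomp .refl).trans (hid_hcomp_cellEq _)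
  | hcomp_hid a =>
    refine CellEq.eq ((𝓜.eval_recast _ _ _ _ _).trans ((𝓜.eval_hcomp _ _).trans ?_))
    exact (CellEq.hcomp .refl (𝓜.eval_hid _)).trans (hcomp_hid_cellEq _)
  | vcomp_assoc a b c =>
    refine CellEq.eq ((𝓜.eval_recast _ _ _ _ _).trans ?_)
    refine ((𝓜.eval_vcomp _ _).trans ((𝓜.eval_vcomp _ _).vcomp .refl)).trans ?_
    refine (vcomp_assoc_cellEq _ _ _).trans (CellEq.symm ?_)
    exact (𝓜.eval_vcomp _ _).trans (CellEq.vcomp .refl (𝓜.eval_vcomp _ _))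
  | vid_vcomp a =>
    refine CellEq.eq ((𝓜.eval_recast _ _ _ _ _).trans ((𝓜.eval_vcomp _ _).trans ?_))
    exact ((𝓜.eval_vid _).vcomp .refl).trans (vid_vcomp_cellEq _)
  | vcomp_vid a =>
    refine CellEq.eq ((𝓜.eval_recast _ _ _ _ _).trans ((𝓜.eval_vcomp _ _).trans ?_))
    exact (CellEq.vcomp .refl (𝓜.eval_vid _)).trans (vcomp_vid_cellEq _)
  | hid_mul X Y =>
    refine CellEq.eq ((𝓜.eval_vcomp _ _).trans (((𝓜.eval_hid _).vcomp (𝓜.eval_hid _)).trans ?_))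
    refine (CellEq.of_eq (𝔻.hid_mul _ _)).trans (CellEq.trans ?_ (𝓜.eval_hid _).symm)
    exact hid_congr (map_mul 𝓜.edgeV _ _).symm
  | vid_tensor S T =>
    refine CellEq.eq ((𝓜.eval_hcomp _ _).trans (((𝓜.eval_vid _).hcomp (𝓜.eval_vid _)).trans ?_))
    refine (CellEq.of_eq (𝔻.vid_mul _ _)).trans (CellEq.trans ?_ (𝓜.eval_vid _).symm)
    exact vid_congr (𝓜.edgeH_tensor _ _).symm
  | hid_one =>
    refine CellEq.eq ((𝓜.eval_hid _).trans (CellEq.trans ?_ (𝓜.eval_vid _).symm))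
    exact (hid_congr (map_one 𝓜.edgeV)).trans ((CellEq.of_eq 𝔻.hid_one).trans
      (vid_congr 𝓜.edgeH_unit.symm))
  | interchange a b c d =>
    refine CellEq.eq ((𝓜.eval_hcomp _ _).trans ?_)
    refine ((𝓜.eval_vcomp _ _).hcomp (𝓜.eval_vcomp _ _)).trans ?_
    refine (interchange_cellEq _ _ _ _).trans (CellEq.symm ?_)
    exact (𝓜.eval_vcomp _ _).trans ((𝓜.eval_hcomp _ _).vcomp (𝓜.eval_hcomp _ _))
  | gen_id P =>
    exact ((𝓜.eval_gen _).trans ((CellEq.of_eq (𝓜.gen_id P)).trans (𝓜.eval_vid P).symm)).eq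
  | gen_comp f g =>
    refine CellEq.eq ((𝓜.eval_recast _ _ _ _ _).trans ((𝓜.eval_vcomp _ _).trans ?_))
    exact ((𝓜.eval_gen f).vcomp (𝓜.eval_gen g)).trans
      ((𝓜.gen_comp f g).trans (𝓜.eval_gen _).symm)
  | gen_tensor f g =>
    refine CellEq.eq ((𝓜.eval_hcomp _ _).trans ?_)
    exact ((𝓜.eval_gen f).hcomp (𝓜.eval_gen g)).trans
      ((𝓜.gen_tensor f g).trans (𝓜.eval_gen _).symm)
  | circ_yank_h P =>
    refine CellEq.eq ((𝓜.eval_recast _ _ _ _ _).trans ((𝓜.eval_hcomp _ _).trans ?_))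
    exact ((𝓜.eval_circR P).hcomp (𝓜.eval_circL P)).trans
      ((𝓜.circ_yank_h P).trans (𝓜.eval_vid P).symm)
  | circ_yank_v P =>
    refine CellEq.eq ((𝓜.eval_recast _ _ _ _ _).trans ((𝓜.eval_vcomp _ _).trans ?_))
    exact ((𝓜.eval_circL P).vcomp (𝓜.eval_circR P)).trans
      ((𝓜.circ_yank_v P).trans (𝓜.eval_hid _).symm)
  | bullet_yank_h P =>
    refine CellEq.eq ((𝓜.eval_recast _ _ _ _ _).trans ((𝓜.eval_hcomp _ _).trans ?_))
    exact ((𝓜.eval_bulletR P).hcomp (𝓜.eval_bulletL P)).trans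
      ((𝓜.bullet_yank_h P).trans (𝓜.eval_vid P).symm)
  | bullet_yank_v P =>
    refine CellEq.eq ((𝓜.eval_recast _ _ _ _ _).trans ((𝓜.eval_vcomp _ _).trans ?_))
    exact ((𝓜.eval_bulletR P).vcomp (𝓜.eval_bulletL P)).trans
      ((𝓜.bullet_yank_v P).trans (𝓜.eval_hid _).symm)

/-- The interpretation of a cell of the free cornering. -/
def evalCell [StrictMonoidal A] (c : (freeCornering A).Cell X S T Y) :
    𝔻.Cell (𝓜.edgeV X) (𝓜.edgeH S) (𝓜.edgeH T) (𝓜.edgeV Y) :=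
  Quot.lift 𝓜.eval (fun _ _ h => 𝓜.eval_eq_of_rel h) c

end CorneringModel

/-! ### The presheaf model -/

namespace PresheafModel

open SingleObjectDoubleCategory

variable (A : Type u) [Category.{v} A]

/-- Presheaves, valued in a universe that accommodates coends. -/
abbrev Psh : Type (max u (v + 1) (u + 1)) := Aᵒᵖ ⥤ Type (max u v)

variable {A}

/-- Restriction of presheaves along an endofunctor. -/
abbrev res (G : A ⥤ A) : Psh A ⥤ Psh A := (Functor.whiskeringLeft _ _ _).obj G.op

/-- A natural transformation of endofunctors acts on restrictions. -/
def resCell {G G' : A ⥤ A} (τ : G ⟶ G') :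
    (quintets (Psh A)).Cell (𝟭 _) (res G) (res G') (𝟭 _) :=
  ((Functor.whiskeringLeft _ _ (Type (max u v))).map (NatTrans.op τ) : res G' ⟶ res G)

theorem resCell_cellEq {G G' K K' : A ⥤ A} (hG : G = K) (hG' : G' = K') {τ : G ⟶ G'}
    {σ : K ⟶ K'} (h : ∀ N, τ.app N ≍ σ.app N) : CellEq (resCell τ) (resCell σ) := by
  subst hG hG'
  obtain rfl : τ = σ := NatTrans.ext (funext fun N => eq_of_heq (h N))
  exact .refl

theorem resCell_vcomp {G G' G'' : A ⥤ A} (τ : G ⟶ G') (σ : G' ⟶ G'') :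
    (quintets (Psh A)).vcomp (resCell τ) (resCell σ) = resCell (τ ≫ σ) :=
  NatTrans.ext (funext fun F => NatTrans.ext (funext fun _ => (F.map_comp _ _).symm))

theorem resCell_hcomp {G G' H H' : A ⥤ A} (τ : G ⟶ G') (σ : H ⟶ H') :
    (quintets (Psh A)).hcomp (resCell τ) (resCell σ) = resCell (G := G ⋙ H) (τ ◫ σ) :=
  NatTrans.ext (funext fun F => NatTrans.ext (funext fun _ => (F.map_comp _ _).symm))

variable [MonoidalCategory A] [StrictMonoidal A]

theorem tensorRight_unit : tensorRight (𝟙_ A) = 𝟭 A :=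
  CategoryTheory.Functor.ext (fun N => StrictMonoidal.tensor_unit N) fun M N f => by
    have h := rightUnitor_naturality f
    rw [StrictMonoidal.rightUnitor_eq, StrictMonoidal.rightUnitor_eq] at h
    simp only [eqToIso.hom] at h
    simp [← reassoc_of% h]

/-- Restriction reverses composition of functors, and so does the product of `endofunctorMonoid`;
hence `S ↦ res (tensorRight S)` is strictly multiplicative in the right order. -/
theorem tensorRight_tensor (S T : A) :
    tensorRight (S ⊗ T) = tensorRight S ⋙ tensorRight T :=
  CategoryTheory.Functor.ext (fun N => (StrictMonoidal.tensor_assoc N S T).symm) fun M N f => by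
    simp [whiskerRight_tensor, StrictMonoidal.associator_eq]

/-- The functor by which a letter of the exchange monoid acts: left Kan extension for `P°`,
restriction for `P•`. -/
noncomputable def letter : A × Polarity → (Psh A ⥤ Psh A)
  | (P, .circ) => (tensorRight P).op.lan
  | (P, .bullet) => res (tensorRight P)

/-- The functor of `P°` is left adjoint to restriction along `- ⊗ P`. -/
noncomputable def adj (P : A) : letter (P, Polarity.circ) ⊣ res (tensorRight P) :=
  (tensorRight P).op.lanAdjunction (Type (max u v))

theorem tensoringRight_map_tensorHom_app_heq {P Q P' Q' : A} (f : P ⟶ Q) (g : P' ⟶ Q') (N : A) :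
    ((tensoringRight A).map f ◫ (tensoringRight A).map g).app N ≍
      ((tensoringRight A).map (f ⊗ₘ g)).app N := by
  have h : ((tensoringRight A).map (f ⊗ₘ g)).app N = (α_ N P P').inv ≫
      ((tensoringRight A).map f ◫ (tensoringRight A).map g).app N ≫ (α_ N Q Q').hom := by
    -- Horizontal composition of transformations applies `g` first, while `tensorHom_def` applies
    -- `f` first.
    have e := congrArg (N ◁ ·) (whisker_exchange f g)
    simp only [MonoidalCategory.whiskerLeft_comp] at e
    simp [MonoidalCategory.tensorHom_def, e]
  rw [h, StrictMonoidal.associator_eq, StrictMonoidal.associator_eq]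
  change _ ≍ eqToHom (StrictMonoidal.tensor_assoc N P P').symm ≫ _ ≫
    eqToHom (StrictMonoidal.tensor_assoc N Q Q')
  exact ((eqToHom_comp_heq _ _).trans (comp_eqToHom_heq _ _)).symm

variable (A) in
/-- The model of the free cornering in the quintets of the category of presheaves. -/
noncomputable def model : CorneringModel A (quintets (Psh A)) where
  edgeH S := res (tensorRight S)
  edgeV := FreeMonoid.lift letter
  edgeH_unit := congrArg res tensorRight_unit
  edgeH_tensor S T := congrArg res (tensorRight_tensor S T)
  gen f := resCell ((tensoringRight A).map f)
  circR P := (adj P).unit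
  circL P := (adj P).counit
  bulletR P := 𝟙 (res (tensorRight P))
  bulletL P := 𝟙 (res (tensorRight P))
  gen_id P := by
    rw [(tensoringRight A).map_id]
    exact NatTrans.ext (funext fun F => NatTrans.ext (funext fun _ => F.map_id _))
  gen_comp f g := by
    rw [(tensoringRight A).map_comp]
    exact .of_eq (resCell_vcomp _ _)
  gen_tensor {P Q P' Q'} f g := (CellEq.of_eq (resCell_hcomp _ _)).trans
    (resCell_cellEq (tensorRight_tensor P P').symm (tensorRight_tensor Q Q').symm
      (tensoringRight_map_tensorHom_app_heq f g))
  -- The yanking equations for `P°` are the triangle identities; for `P•` they compose identities.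
  circ_yank_h P := by
    exact .of_eq (NatTrans.ext (funext fun F => (adj P).right_triangle_components F))
  circ_yank_v P := by
    exact .of_eq (NatTrans.ext (funext fun F => (adj P).left_triangle_components F))
  bullet_yank_h P := by
    refine .of_eq (NatTrans.ext (funext fun F => Category.comp_id _))
  bullet_yank_v P := by
    refine .of_eq (NatTrans.ext (funext fun F => Category.comp_id _))

end PresheafModel

/-! ### Recovering an optic from its action on presheaves -/

namespace PresheafModel

open SingleObjectDoubleCategory

variable {A : Type u} [Category.{v} A] [MonoidalCategory A]

/-- The presheaf represented by an object. -/
abbrev representable (Q : A) : Psh A := yoneda.obj Q ⋙ uliftFunctor.{u}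

/-- Optics with varying first component of the domain. -/
def opticPresheaf (Q C D : A) : Psh A where
  obj N := Optic.Hom ⟨N.unop, Q⟩ ⟨C, D⟩
  map f := TypeCat.ofHom (Quot.map (fun p => ⟨p.residual, f.unop ≫ p.fwd, p.bwd⟩) (by
    rintro _ _ ⟨g, α, β⟩
    simpa using OpticRep.Slide.slide g (f.unop ≫ α) β))
  map_id N := by
    ext ⟨p⟩
    exact congrArg (Quot.mk _) (by simp)
  map_comp f g := by
    ext ⟨p⟩
    exact congrArg (Quot.mk _) (by simp)

/-- The optic whose forward part is an identity. -/
def bwdOptic (Q C D : A) :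
    (res (tensorRight D)).obj (representable Q) ⟶
      (res (tensorRight C)).obj (opticPresheaf Q C D) where
  app K := TypeCat.ofHom fun β =>
    Optic.Hom.mk (X := ⟨K.unop ⊗ C, Q⟩) (Y := ⟨C, D⟩) K.unop (𝟙 _) β.down
  naturality K L f := by
    ext β
    -- Naturality in the residual is exactly the sliding relation.
    have h := Optic.Hom.slide (X := ⟨L.unop ⊗ C, Q⟩) (Y := ⟨C, D⟩) f.unop (𝟙 _) β.down
    refine h.symm.trans (congrArg (Quot.mk _) ?_)
    simp

/-- Transformations between the functors by which `P° ⊗ Q•` and `C° ⊗ D•` act. -/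
abbrev Transformation (P Q C D : A) :=
  res (tensorRight Q) ⋙ letter (P, .circ) ⟶ res (tensorRight D) ⋙ letter (C, .circ)

/-- The element of a representable presheaf given by an arrow. -/
def element {N Q : A} (f : N ⟶ Q) : (representable Q).obj (op N) := ⟨f⟩

/-- The optic recovered from a transformation, by evaluation at a representable presheaf. -/
noncomputable def opticOfTransformation {P Q C D : A} (τ : Transformation P Q C D) :
    Optic.Hom (⟨P, Q⟩ : Optic A) ⟨C, D⟩ :=
  -- Read from the bottom: the universal element `1_Q`, seen at `I ⊗ Q`, enters the Kan extension
  -- along `- ⊗ P` by the unit, is moved by `τ`, and goes to optics by the transpose of `bwdOptic`.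
  -- The last map replaces `I ⊗ P` by `P`.
  (opticPresheaf Q C D).map (λ_ P).inv.op <|
    (((adj C).homEquiv _ _).symm (bwdOptic Q C D)).app (op (𝟙_ A ⊗ P)) <|
    (τ.app (representable Q)).app (op (𝟙_ A ⊗ P)) <|
    ((adj P).unit.app ((res (tensorRight Q)).obj (representable Q))).app (op (𝟙_ A))
      (element (λ_ Q).hom)

/-- The natural transformation from `- ⊗ P` to `(- ⊗ M) ⊗ C` given by an arrow `P ⟶ M ⊗ C`. -/
def splitTarget {P M C : A} (α : P ⟶ M ⊗ C) : tensorRight P ⟶ tensorRight M ⋙ tensorRight C where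
  app N := N ◁ α ≫ (α_ N M C).inv
  naturality K L f := by simp [← whisker_exchange_assoc]

/-- The natural transformation from `(- ⊗ M) ⊗ D` to `- ⊗ Q` given by an arrow `M ⊗ D ⟶ Q`. -/
def splitSource {M D Q : A} (β : M ⊗ D ⟶ Q) : tensorRight M ⋙ tensorRight D ⟶ tensorRight Q where
  app N := (α_ N M D).hom ≫ N ◁ β
  naturality K L f := by simp [whisker_exchange]

/-- The composite of all cells of `[α ∣ β]_M` but the first, in the presheaf model. -/
noncomputable def transposedOpticCell {P Q C D : A} (M : A) (α : P ⟶ M ⊗ C) (β : M ⊗ D ⟶ Q) :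
    res (tensorRight Q) ⟶ (res (tensorRight D) ⋙ letter (C, .circ)) ⋙ res (tensorRight P) :=
  let 𝔼 := quintets (Psh A)
  𝔼.vcomp (resCell (splitTarget α)) <|
    𝔼.vcomp (𝔼.hcomp (Y := (𝟭 _ : Psh A ⥤ Psh A)) (Z := letter (C, .circ))
      (S' := res (tensorRight C)) (T' := (𝟭 _ : Psh A ⥤ Psh A))
      (𝔼.vid (res (tensorRight M))) (adj C).unit) <|
    𝔼.vcomp (𝔼.hcomp (Y := (𝟭 _ : Psh A ⥤ Psh A)) (Z := res (tensorRight D))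
      (S' := (𝟭 _ : Psh A ⥤ Psh A)) (T' := res (tensorRight D))
      (𝔼.vid (res (tensorRight M))) (𝟙 (res (tensorRight D)))) <|
    𝔼.vcomp (X' := res (tensorRight Q)) (U := (𝟭 _ : Psh A ⥤ Psh A)) (Y' := (𝟭 _ : Psh A ⥤ Psh A))
      (resCell (splitSource β)) (𝟙 (res (tensorRight Q)))

/-- The transformation by which the cell `[α ∣ β]_M` acts. -/
noncomputable def opticTransformation {P Q C D : A} (M : A) (α : P ⟶ M ⊗ C) (β : M ⊗ D ⟶ Q) :
    Transformation P Q C D :=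
  Functor.whiskerRight (transposedOpticCell M α β) (letter (P, .circ)) ≫
    Functor.whiskerLeft (res (tensorRight D) ⋙ letter (C, .circ)) (adj P).counit

theorem transposedOpticCell_app_app {P Q C D : A} (M : A) (α : P ⟶ M ⊗ C) (β : M ⊗ D ⟶ Q)
    (F : Psh A) (N : A) (x : F.obj (op (N ⊗ Q))) :
    ((transposedOpticCell M α β).app F).app (op N) x =
      ((letter (C, .circ)).obj ((res (tensorRight D)).obj F)).map
        (N ◁ α ≫ (α_ N M C).inv).op
        (((adj C).unit.app ((res (tensorRight D)).obj F)).app (op (N ⊗ M))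
          (F.map ((α_ N M D).hom ≫ N ◁ β).op x)) := by
  rfl

/-- The first corner of `[α ∣ β]_M` acts as the counit, so the whole transformation is the adjoint
transpose of the remaining layers; transposing back strips the corner off. -/
theorem unit_opticTransformation {P Q C D : A} (M : A) (α : P ⟶ M ⊗ C) (β : M ⊗ D ⟶ Q)
    (F : Psh A) :
    (adj P).unit.app ((res (tensorRight Q)).obj F) ≫
        (res (tensorRight P)).map ((opticTransformation M α β).app F) =
      (transposedOpticCell M α β).app F := by
  have h : (opticTransformation M α β).app F =
      ((adj P).homEquiv _ _).symm ((transposedOpticCell M α β).app F) := by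
    rw [Adjunction.homEquiv_counit]
    rfl
  rw [h]
  exact ((adj P).homEquiv_unit _ _ _).symm.trans (((adj P).homEquiv _ _).apply_symm_apply _)

theorem opticOfTransformation_opticTransformation {P Q C D : A} (M : A) (α : P ⟶ M ⊗ C)
    (β : M ⊗ D ⟶ Q) :
    opticOfTransformation (opticTransformation M α β) =
      Optic.Hom.mk (X := ⟨P, Q⟩) (Y := ⟨C, D⟩) M α β := by
  have h1 := ConcreteCategory.congr_hom
    (congr_app (unit_opticTransformation M α β (representable Q)) (op (𝟙_ A))) (element (λ_ Q).hom)
  have h2 := transposedOpticCell_app_app M α β (representable Q) (𝟙_ A) (element (λ_ Q).hom)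
  have h3 : (adj C).unit.app _ ≫ (res (tensorRight C)).map
    (((adj C).homEquiv _ _).symm (bwdOptic Q C D)) = bwdOptic Q C D :=
    ((adj C).homEquiv_unit _ _ _).symm.trans (((adj C).homEquiv _ _).apply_symm_apply _)
  have h4 := fun x => ConcreteCategory.congr_hom (congr_app h3 (op (𝟙_ A ⊗ M))) x
  have h5 := fun x => ConcreteCategory.congr_hom
    ((((adj C).homEquiv _ _).symm (bwdOptic Q C D)).naturality (𝟙_ A ◁ α ≫ (α_ (𝟙_ A) M C).inv).op) x
  unfold opticOfTransformation
  refine (congrArg (fun z => (opticPresheaf Q C D).map (λ_ P).inv.op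
    ((((adj C).homEquiv _ _).symm (bwdOptic Q C D)).app (op (𝟙_ A ⊗ P)) z))
    (h1.trans h2)).trans ?_
  refine (congrArg ((opticPresheaf Q C D).map (λ_ P).inv.op) ((h5 _).trans
    (congrArg ((opticPresheaf Q C D).map (𝟙_ A ◁ α ≫ (α_ (𝟙_ A) M C).inv).op) (h4 _)))).trans ?_
  change Optic.Hom.mk (X := ⟨P, Q⟩) (Y := ⟨C, D⟩) (𝟙_ A ⊗ M)
    ((λ_ P).inv ≫ (𝟙_ A ◁ α ≫ (α_ (𝟙_ A) M C).inv) ≫ 𝟙 _)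
    (((α_ (𝟙_ A) M D).hom ≫ 𝟙_ A ◁ β) ≫ (λ_ Q).hom) = _
  -- Evaluation at `I` leaves the residual `I ⊗ M`; sliding along the unitor turns it into `M`.
  have h := Optic.Hom.slide (X := ⟨P, Q⟩) (Y := ⟨C, D⟩) (λ_ M).inv α
    (((α_ (𝟙_ A) M D).hom ≫ 𝟙_ A ◁ β) ≫ (λ_ Q).hom)
  refine Eq.trans ?_ (h.trans ?_)
  · congr 1
    simp
  · congr 1
    simp

variable [StrictMonoidal A]

/-- The transformation by which a cell from `P° ⊗ Q•` to `C° ⊗ D•` acts. -/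
noncomputable def transformationOfCell {P Q C D : A} (x : circBullet P Q ⟶ circBullet C D) :
    Transformation P Q C D :=
  castCell (𝔻 := quintets (Psh A)) (X := (model A).edgeV (circ P * bullet Q))
    (X' := (res (tensorRight Q) ⋙ letter (P, .circ) : Psh A ⥤ Psh A))
    (Y' := (res (tensorRight D) ⋙ letter (C, .circ) : Psh A ⥤ Psh A)) (S' := 𝟭 _) (T' := 𝟭 _)
    (map_mul (model A).edgeV (circ P) (bullet Q)) (model A).edgeH_unit
    (model A).edgeH_unit (map_mul (model A).edgeV (circ C) (bullet D)) ((model A).evalCell x)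

theorem transformationOfCell_cellEq {P Q C D : A} (x : circBullet P Q ⟶ circBullet C D) :
    CellEq (𝔻 := quintets (Psh A)) (S := (𝟭 _ : Psh A ⥤ Psh A)) (T := (𝟭 _ : Psh A ⥤ Psh A))
      (X := (res (tensorRight Q) ⋙ letter (P, .circ) : Psh A ⥤ Psh A))
      (Y := (res (tensorRight D) ⋙ letter (C, .circ) : Psh A ⥤ Psh A))
      (transformationOfCell x) ((model A).evalCell x) :=
  castCell_cellEq (𝔻 := quintets (Psh A)) (X := (model A).edgeV (circ P * bullet Q))
    (map_mul (model A).edgeV (circ P) (bullet Q)) (model A).edgeH_unit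
    (model A).edgeH_unit (map_mul (model A).edgeV (circ C) (bullet D)) _

theorem resCell_splitTarget_cellEq {P M C : A} (α : P ⟶ M ⊗ C) :
    CellEq ((model A).gen α) (resCell (splitTarget α)) :=
  resCell_cellEq rfl (tensorRight_tensor M C) fun N => by
    change N ◁ α ≍ N ◁ α ≫ (α_ N M C).inv
    rw [StrictMonoidal.associator_eq]
    exact (comp_eqToHom_heq _ (StrictMonoidal.tensor_assoc N M C).symm).symm

theorem resCell_splitSource_cellEq {Q M D : A} (β : M ⊗ D ⟶ Q) :
    CellEq ((model A).gen β) (resCell (splitSource β)) :=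
  resCell_cellEq (tensorRight_tensor M D) rfl fun N => by
    change N ◁ β ≍ (α_ N M D).hom ≫ N ◁ β
    rw [StrictMonoidal.associator_eq]
    exact (eqToHom_comp_heq _ (StrictMonoidal.tensor_assoc N M D)).symm

theorem transformationOfCell_opticCell {P Q C D : A} (M : A) (α : P ⟶ M ⊗ C) (β : M ⊗ D ⟶ Q) :
    transformationOfCell (opticCell M α β) = opticTransformation M α β := by
  refine CellEq.eq (𝔻 := quintets (Psh A)) (S := (𝟭 _ : Psh A ⥤ Psh A))
    (T := (𝟭 _ : Psh A ⥤ Psh A)) ((transformationOfCell_cellEq _).trans ?_)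
  refine CellEq.trans (b := (model A).eval (opticExpr M α β)) .refl ?_
  refine ((model A).eval_recast _ _ _ _ _).trans ?_
  -- The top corner is interpreted by the counit `c` and all lower layers by `b`;
  -- `opticTransformation` is by definition `c` above `b`.
  let c : (quintets (Psh A)).Cell (letter (P, .circ)) (𝟭 _ : Psh A ⥤ Psh A)
    (res (tensorRight P)) (𝟭 _ : Psh A ⥤ Psh A) := (adj P).counit
  let b : (quintets (Psh A)).Cell (res (tensorRight Q)) (res (tensorRight P))
    (𝟭 _ : Psh A ⥤ Psh A) (res (tensorRight D) ⋙ letter (C, .circ) : Psh A ⥤ Psh A) :=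
    transposedOpticCell M α β
  have hc : CellEq ((model A).eval (.circL P)) c := (model A).eval_circL P
  refine CellEq.trans (b := (quintets (Psh A)).vcomp c b) ?_ .refl
  refine ((model A).eval_vcomp _ _).trans (hc.vcomp ?_)
  have hM := (model A).eval_vid M
  refine ((model A).eval_vcomp _ _).trans
    ((((model A).eval_gen α).trans (resCell_splitTarget_cellEq α)).vcomp ?_)
  refine ((model A).eval_vcomp _ _).trans
    ((((model A).eval_hcomp _ _).trans (hM.hcomp ((model A).eval_circR C))).vcomp ?_)
  refine ((model A).eval_vcomp _ _).trans
    ((((model A).eval_hcomp _ _).trans (hM.hcomp ((model A).eval_bulletR D))).vcomp ?_)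
  exact ((model A).eval_vcomp _ _).trans
    ((((model A).eval_gen β).trans (resCell_splitSource_cellEq β)).vcomp ((model A).eval_bulletL Q))

/-- Optics that give the same cell are equal. -/
theorem optic_eq_of_opticCell_eq {P Q C D M N : A} {α : P ⟶ M ⊗ C} {β : M ⊗ D ⟶ Q}
    {γ : P ⟶ N ⊗ C} {δ : N ⊗ D ⟶ Q} (h : opticCell M α β = opticCell N γ δ) :
    Optic.Hom.mk (X := ⟨P, Q⟩) (Y := ⟨C, D⟩) M α β = Optic.Hom.mk N γ δ := by
  rw [← opticOfTransformation_opticTransformation, ← opticOfTransformation_opticTransformation,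
    ← transformationOfCell_opticCell, ← transformationOfCell_opticCell, h]

end PresheafModel

/-! ### Coends and the isomorphism of categories -/

section

variable {A : Type u} [Category.{v} A] [MonoidalCategory A]

/-- The cowedge of classes of representatives of optics. -/
def opticCowedge {P Q C D : A} (M : A) :
    ((opticBifunctor P Q C D).obj (op M)).obj M ⟶ Optic.Hom (⟨P, Q⟩ : Optic A) ⟨C, D⟩ :=
  TypeCat.ofHom fun p => Optic.Hom.mk (X := ⟨P, Q⟩) (Y := ⟨C, D⟩) M p.down.1 p.down.2

theorem opticCowedge_condition (P Q C D : A) ⦃M N : A⦄ (f : M ⟶ N) :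
    ((opticBifunctor P Q C D).map f.op).app M ≫ opticCowedge M =
      ((opticBifunctor P Q C D).obj (op N)).map f ≫ opticCowedge N := by
  ext p
  exact (Optic.Hom.slide (X := ⟨P, Q⟩) (Y := ⟨C, D⟩) f p.down.1 p.down.2).symm

open Limits in
/-- The element of the coend given by an optic. -/
noncomputable def coendOfOptic {P Q C D : A} :
    Optic.Hom (⟨P, Q⟩ : Optic A) ⟨C, D⟩ → coend (opticBifunctor P Q C D) :=
  Quot.lift (fun p => coend.ι (opticBifunctor P Q C D) p.residual ⟨(p.fwd, p.bwd)⟩) (by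
  rintro _ _ ⟨f, α, β⟩
  exact (ConcreteCategory.congr_hom (coend.condition (opticBifunctor P Q C D) f) ⟨(α, β)⟩).symm)

open Limits in
/-- Optics as elements of a coend. -/
noncomputable def coendEquivOptic (P Q C D : A) :
    coend (opticBifunctor P Q C D) ≃ Optic.Hom (⟨P, Q⟩ : Optic A) ⟨C, D⟩ where
  toFun := coend.desc (F := opticBifunctor P Q C D)
    opticCowedge (opticCowedge_condition P Q C D)
  invFun := coendOfOptic
  left_inv x := by
    have h : coend.desc (F := opticBifunctor P Q C D) opticCowedge
        (opticCowedge_condition P Q C D) ≫ TypeCat.ofHom coendOfOptic = 𝟙 _ :=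
      coend.hom_ext fun M => by
        rw [coend.ι_desc_assoc, Category.comp_id]
        rfl
    exact ConcreteCategory.congr_hom h x
  right_inv := by
    rintro ⟨⟨M, α, β⟩⟩
    exact ConcreteCategory.congr_hom (coend.ι_desc (F := opticBifunctor P Q C D) opticCowedge
      (opticCowedge_condition P Q C D) M) ⟨(α, β)⟩

variable [StrictMonoidal A]

open FreeCornering PresheafModel

/-- The functor from optics to horizontal cells. -/
def opticCellFunctor : Optic A ⥤ (isCircBullet A).FullSubcategory where
  obj X := circBulletObj X
  map {X Y} := Quot.lift (fun p => opticCellHom (X := X) (Y := Y) p.residual p.fwd p.bwd) (by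
    rintro _ _ ⟨f, α, β⟩
    exact congrArg ObjectProperty.homMk (opticCell_slide f α β))
  map_id X := congrArg ObjectProperty.homMk (opticCell_id X.fst X.snd)
  map_comp := by
    rintro X Y Z ⟨⟨M, α, β⟩⟩ ⟨⟨N, γ, δ⟩⟩
    exact congrArg ObjectProperty.homMk (opticCell_comp M N α β γ δ)

/-- Freeness of the vertical edge monoid. Injectivity on objects is what separates an isomorphism of
categories from an equivalence. -/
theorem circBullet_injective {P Q C D : A} (h : circBullet P Q = circBullet C D) :
    P = C ∧ Q = D := by
  have h' : FreeMonoid.toList (circ P * bullet Q) = FreeMonoid.toList (circ C * bullet D) :=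
    congrArg (fun X : HorizontalCells (freeCornering A) => FreeMonoid.toList X.edge) h
  simpa [circ, bullet] using h'

instance : (opticCellFunctor (A := A)).IsIso where
  faithful := ⟨by
    rintro X Y ⟨⟨M, α, β⟩⟩ ⟨⟨N, γ, δ⟩⟩ h
    exact optic_eq_of_opticCell_eq (congrArg InducedCategory.Hom.hom h)⟩
  full := ⟨by
    rintro X Y x
    obtain ⟨M, α, β, h⟩ := exists_eq_opticCell x.hom
    exact ⟨Optic.homMk M α β, congrArg ObjectProperty.homMk h.symm⟩⟩
  bijective_obj := by
    constructor
    · intro X Y h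
      obtain ⟨h1, h2⟩ := circBullet_injective (congrArg ObjectProperty.FullSubcategory.obj h)
      exact Optic.ext h1 h2
    · rintro ⟨_, P, Q, rfl⟩
      exact ⟨⟨P, Q⟩, rfl⟩

end

theorem theorem1 (A : Type u) [Category.{v} A] [MonoidalCategory A] [StrictMonoidal A] :
    -- the category of optics is isomorphic to the full subcategory, by `(P, Q) ↦ P° ⊗ Q•` on
    -- objects and by sending each optic `⟨α ∣ β⟩_M` to the corresponding cell
    (∃ (Φ : IsoCat (Optic A) (isCircBullet A).FullSubcategory)
      (hobj : ∀ X : Optic A, Φ.functor.obj X = circBulletObj X),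
      ∀ (X Y : Optic A) (M : A) (α : X.fst ⟶ M ⊗ Y.fst) (β : M ⊗ Y.snd ⟶ X.snd),
        Φ.functor.map (Optic.homMk M α β) =
          eqToHom (hobj X) ≫ opticCellHom M α β ≫ eqToHom (hobj Y).symm) ∧
    -- the sets of horizontal cells are coends, with the cells `⟨α ∣ β⟩_M` as universal cowedge
    (∀ P Q C D : A,
      ∃ e : Limits.coend (opticBifunctor P Q C D) ≃ (circBullet P Q ⟶ circBullet C D),
        ∀ (M : A) (α : P ⟶ M ⊗ C) (β : M ⊗ D ⟶ Q),
          e (Limits.coend.ι (opticBifunctor P Q C D) M ⟨(α, β)⟩) = opticCell M α β) := by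
  constructor
  · refine ⟨opticCellFunctor.asIsomorphism, fun _ => rfl, fun X Y M α β => ?_⟩
    exact ((Category.id_comp _).trans (Category.comp_id _)).symm
  · intro P Q C D
    let F := opticCellFunctor (A := A)
    have hF : Function.Bijective (fun f : (⟨P, Q⟩ : Optic A) ⟶ ⟨C, D⟩ => (F.map f).hom) :=
      ⟨fun f g h => F.map_injective (InducedCategory.Hom.ext h), fun x => by
        obtain ⟨f, hf⟩ := F.map_surjective (ObjectProperty.homMk x)
        exact ⟨f, congrArg InducedCategory.Hom.hom hf⟩⟩
    refine ⟨(coendEquivOptic P Q C D).trans (Equiv.ofBijective _ hF), fun M α β => ?_⟩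
    -- The element of the coend at `(α, β)` is by definition `coendOfOptic` of the optic, so the
    -- right inverse law evaluates the bijection on it.
    exact congrArg (fun f : (⟨P, Q⟩ : Optic A) ⟶ ⟨C, D⟩ => (F.map f).hom)
      ((coendEquivOptic P Q C D).right_inv (Optic.Hom.mk M α β))
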